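/- **Notation.** Let $p\ge 1$, $\gamma=(\gamma_1,\dots,\gamma_{p+1})\in\mathbb R^{p+1}$, $N\in\mathbb R$, $n\in\mathbb N_0^p$, $y\in\mathbb R^p$. Write $|n|=n_1+\dots+n_p$, $N_1^k=n_1+\dots+n_k$, $\gamma_1^k=\gamma_1+\dots+\gamma_k$, $Y_1^k=y_1+\dots+y_k$, with $y_{p+1}=N-|y|$ (so $Y_1^{p+1}=N$), and $(x)_k=x(x+1)\cdots(x+k-1)$. Let $$h_n(x;a;b;N)=(a+1)_n(-N)_n\;{}_3F_2\!\left[{-n,\;n+a+b+1,\;-x\atop a+1,\;-N};1\right]$$ (a polynomial in $x,a,b,N$ after cancellation), and let $$H_p(n;y;\gamma;N)=\frac{(-1)^{|n|}}{(-N)_{|n|}\prod_{k=1}^p(\gamma_{k+1}+1)_{n_k}}\prod_{k=1}^p h_{n_k}\bigl(Y_1^k-N_1^{k-1};\,2N_1^{k-1}+\gamma_1^k+k-1;\,\gamma_{k+1};\,Y_1^{k+1}-N_1^{k-1}\bigr)$$ be the multivariable Hahn polynomials of Karlin and McGregor. For $1\le j\le p$ put $$\tilde{\mathfrak L}^y_j=\sum_{1\le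 l\ne m\le j+1}(y_l+\gamma_l+1)\,y_m\,(E_{y_l}E_{y_m}^{-1}-1),$$ where $E_{y_l}$ is the unit shift in $y_l$ and $E_{y_{p+1}}=1$. *Racah operators.* For variables $x_1,\dots,x_{j+1}$ and parameters $\beta_0,\dots,\beta_{j+1}$ let $$\mathcal L_j=\mathcal L_j(x_1,\dots,x_j;\beta_0,\dots,\beta_{j+1};x_{j+1})=\sum_{0\ne\nu\in\{-1,0,1\}^j}(-1)^{|\nu^-|}A_\nu\,\triangle_x^{\nu^+}\nabla_x^{\nu^-},\qquad \triangle_{x_i}=E_{x_i}-1,\quad \nabla_{x_i}=1-E_{x_i}^{-1},$$ where $\nu^{\pm}$ are the positive and negative parts of $\nu$. For $\nu\in\{0,1\}^j$ with nonzero entries at $i_1<\dots<i_s$, $$A_\nu=(x_{i_1}+\beta_{i_1}-\beta_0)(x_{i_1}+\beta_{i_1})\frac{\prod_{k=2}^s(x_{i_k}+x_{i_{k-1}}+\beta_{i_k})(x_{i_k}+x_{i_{k-1}}+\beta_{i_k}+1)}{\prod_{k=1}^s(2x_{i_k}+\beta_{i_k})(2x_{i_k}+\beta_{i_k}+1)}(x_{i_s}+\beta_{j+1}+x_{j+1})(x_{j+1}-x_{i_s}),$$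 and in general $A_\nu$ is obtained from $A_{\nu^++\nu^-}$ by substituting $-x_i-\beta_i$ for $x_i$ whenever $\nu_i=-1$. With $x_{p+1}=N$, the operator $\mathfrak L^n_j$ in the variables $n$ is obtained from $\mathcal L_j$ by the simultaneous substitutions $$\beta_0\mapsto\beta_0,\quad \beta_k\mapsto\beta_0-\beta_{p+2-k}-2N+1\ (1\le k\le p+1),\quad N\mapsto N,$$ $$x_k\mapsto N_1^{p+1-k}+\beta_{p+2-k}-\beta_0+N-1,\quad E_{x_k}\mapsto E_{n_{p+1-k}}E_{n_{p+2-k}}^{-1}\ (1\le k\le p),\quad E_{n_{p+1}}=1.$$ Finally put $\beta_k=\beta_0+\gamma_1^k+k$ for $1\le k\le p+1$, so that $\mathfrak L^n_j$ depends on $\beta_0,\gamma,N$, and define $$\tilde{\mathfrak L}^n_j=\lim_{\beta_0\to\infty}\frac1{\beta_0}\,\mathfrak L^n_j .$$ **Theorem 5.2.** Let $1\le j\le p$, and assume that $H_p(n;y;\gamma;N)$ is defined, that is, $|n|\le N$ if $N\in\mathbb N_0$, and $(\gamma_{k+1}+1)_{n_k}\neq0$ for $k=1,\dots,p$. (a)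 For all $y\in\mathbb R^p$, $$\tilde{\mathfrak L}^y_jH_p(n;y;\gamma;N)=\tilde\mu_j(n)H_p(n;y;\gamma;N),\qquad \tilde\mu_j(n)=-N_1^j\,\bigl(N_1^j+j+\gamma_1+\dots+\gamma_{j+1}\bigr).$$ (b) Call $(\gamma,N)$ *regular at $n$* if $(-N)_{|n|+1}\ne0$, $(\gamma_{k+1}+1)_{|n|+1}\ne0$ for $k=1,\dots,p$, and $2N_1^m+\gamma_1^{m+1}+m\notin\{-1,0,1\}$ for $p+1-j\le m\le p$ (so that the coefficients of $\tilde{\mathfrak L}^n_j$ at $n$ and all the $H_p(n';y;\gamma;N)$ with $|n'|\le|n|+1$ are defined). If $(\gamma,N)$ is regular at $n$, then the limit defining $\tilde{\mathfrak L}^n_j$ exists at $n$ (on every function on $\mathbb Z^p$), and for all $y\in\mathbb R^p$ $$\tilde{\mathfrak L}^n_jH_p(n;y;\gamma;N)=\tilde\kappa_j(y)H_p(n;y;\gamma;N),\qquad \tilde\kappa_j(y)=N-y_1-y_2-\dots-y_{p+1-j}.$$ Here $H_p(\cdot\,;y;\gamma;N)$ may be extended from $\mathbb N_0^p$ to $\mathbb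 Z^p$ by arbitrary values. If $(\gamma,N)$ is not regular at $n$ (for example, if $N=|n|$), the equation holds in the limit: its left-hand side for $(\gamma',N')$ tends to $\tilde\kappa_j(y)H_p(n;y;\gamma;N)$ when $(\gamma',N')\to(\gamma,N)$ through parameters that are regular at $n$. -/

import Mathlib

open Filter Topology

noncomputable section

namespace Hahn

/-- The Pochhammer symbol `(x)_k = x (x+1) ⋯ (x+k-1)`. -/
def poch (x : ℝ) (k : ℕ) : ℝ := (ascPochhammer ℝ k).eval x

/-- The partial sum `v₁ + ⋯ + v_k` of a vector `(v₁, …, v_m)`, whose entry `v_i` is `v ⟨i-1, _⟩`. -/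
def psum {m : ℕ} (v : Fin m → ℝ) (k : ℕ) : ℝ := ∑ i : Fin m, if (i : ℕ) < k then v i else 0

/-! ### The polynomials -/

/-- The one-dimensional Hahn polynomial
`h_n(x;a;b;N) = (a+1)_n (-N)_n ₃F₂(-n, n+a+b+1, -x; a+1, -N; 1)`.
The factors `(a+1)_k (-N)_k` in the denominators of the `₃F₂` are cancelled against
`(a+1)_n (-N)_n`, so that this is a polynomial in all of `x, a, b, N`. -/
def hahn1 (n : ℕ) (x a b N : ℝ) : ℝ :=
  ∑ k ∈ Finset.range (n + 1),
    poch (-(n : ℝ)) k * poch (n + a + b + 1) k * poch (-x) k / (k.factorial : ℝ) *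
      (poch (a + 1 + k) (n - k) * poch (-N + k) (n - k))

/-- The definition of `hahn1` agrees with the hypergeometric one wherever the latter makes sense. -/
theorem hahn1_eq (n : ℕ) (x a b N : ℝ) (ha : poch (a + 1) n ≠ 0) (hN : poch (-N) n ≠ 0) :
    hahn1 n x a b N = poch (a + 1) n * poch (-N) n *
      ∑ k ∈ Finset.range (n + 1), poch (-(n : ℝ)) k * poch (n + a + b + 1) k * poch (-x) k /
        (poch (a + 1) k * poch (-N) k * (k.factorial : ℝ)) := by
  have split : ∀ (z : ℝ) (k : ℕ), k ≤ n → poch z n = poch z k * poch (z + k) (n - k) := by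
    intro z k hk
    obtain ⟨d, rfl⟩ := Nat.exists_eq_add_of_le hk
    have h := congrArg (Polynomial.eval z) (ascPochhammer_mul ℝ k d)
    simpa [poch, Polynomial.eval_comp, mul_comm] using h.symm
  rw [hahn1, Finset.mul_sum]
  refine Finset.sum_congr rfl fun k hk => ?_
  have hk' : k ≤ n := Nat.lt_succ_iff.mp (Finset.mem_range.mp hk)
  have h1 := split (a + 1) k hk'
  have h2 := split (-N) k hk'
  have ha' : poch (a + 1) k ≠ 0 := fun h => ha (by rw [h1, h, zero_mul])
  have hN' : poch (-N) k ≠ 0 := fun h => hN (by rw [h2, h, zero_mul])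
  have hf : (k.factorial : ℝ) ≠ 0 := by exact_mod_cast k.factorial_ne_zero
  rw [h1, h2]
  field_simp

/-- `(y₁, …, y_p)` completed by `y_{p+1} = N - |y|`; thus `psum (compl y N) k` is `Y_1^k` for every
`k ≤ p + 1`, and `Y_1^{p+1} = N`. -/
def compl {p : ℕ} (y : Fin p → ℝ) (N : ℝ) : Fin (p + 1) → ℝ := Fin.snoc y (N - ∑ i, y i)

/-- The multivariable Hahn polynomial `H_p(n;y;γ;N)`. The index `k : Fin p` stands for the factor
number `k + 1` of the product, and `γ` lists `γ₁, …, γ_{p+1}`. -/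
def hahnH {p : ℕ} (n : Fin p → ℕ) (y : Fin p → ℝ) (γ : Fin (p + 1) → ℝ) (N : ℝ) : ℝ :=
  (-1) ^ (∑ i, n i) / (poch (-N) (∑ i, n i) * ∏ k : Fin p, poch (γ k.succ + 1) (n k)) *
    ∏ k : Fin p,
      hahn1 (n k)
        (psum (compl y N) (k + 1) - psum (fun i => (n i : ℝ)) k)
        (2 * psum (fun i => (n i : ℝ)) k + psum γ (k + 1) + (k : ℝ))
        (γ k.succ)
        (psum (compl y N) (k + 2) - psum (fun i => (n i : ℝ)) k)

/-- `H_p(n;y;γ;N)` as a function of `n ∈ ℤ^p`: the Hahn polynomial on `ℕ^p`, and the values of an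
arbitrary function `c` elsewhere. -/
def hahnExt {p : ℕ} (c : (Fin p → ℤ) → ℝ) (y : Fin p → ℝ) (γ : Fin (p + 1) → ℝ) (N : ℝ) :
    (Fin p → ℤ) → ℝ := fun n =>
  if ∀ i, 0 ≤ n i then hahnH (fun i => (n i).toNat) y γ N else c n

/-! ### The operators in `y` -/

/-- The vector `e_{l+1}` of `ℝ^p`, with `e_{p+1} = 0`. -/
def unitVec {p : ℕ} (l : Fin (p + 1)) : Fin p → ℝ := fun i => if i.castSucc = l then 1 else 0

/-- `𝔏̃^y_j = ∑_{1 ≤ l ≠ m ≤ j+1} (y_l + γ_l + 1) y_m (E_{y_l} E_{y_m}⁻¹ - 1)`, where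
`y_{p+1} = N - |y|` and `E_{y_{p+1}} = 1`. -/
def hahnOpY {p : ℕ} (j : ℕ) (γ : Fin (p + 1) → ℝ) (N : ℝ) (f : (Fin p → ℝ) → ℝ)
    (y : Fin p → ℝ) : ℝ :=
  ∑ l : Fin (p + 1), ∑ m : Fin (p + 1),
    if l ≠ m ∧ (l : ℕ) < j + 1 ∧ (m : ℕ) < j + 1 then
      (compl y N l + γ l + 1) * compl y N m * (f (y + unitVec l - unitVec m) - f y)
    else 0

/-! ### The Racah operators

Variables `x₁, x₂, …` and parameters `β₀, β₁, …` are sequences indexed by `ℕ`. A multi-index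
`ν ∈ {-1,0,1}^j` is a function `ν : Fin j → SignType`, and `i : Fin j` stands for the coordinate
number `i + 1`. -/

/-- The coefficient `A_ν` (`ν ≠ 0`) of the Racah operator
`ℒ_j(x₁, …, x_j; β₀, …, β_{j+1}; x_{j+1}) = ∑_{ν ≠ 0} (-1)^{|ν⁻|} A_ν Δ_x^{ν⁺} ∇_x^{ν⁻}`.

If all `ν_i ≥ 0` and `i₁ < ⋯ < i_s` are the indices with `ν_i ≠ 0` then `A_ν` is
`(x_{i₁} + β_{i₁} - β₀) (x_{i₁} + β_{i₁})`
`× ∏_{k=2}^s (x_{i_k} + x_{i_{k-1}} + β_{i_k}) (x_{i_k} + x_{i_{k-1}} + β_{i_k} + 1)`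
`/ ∏_{k=1}^s (2 x_{i_k} + β_{i_k}) (2 x_{i_k} + β_{i_k} + 1)`
`× (x_{i_s} + β_{j+1} + x_{j+1}) (x_{j+1} - x_{i_s})`.
In general `A_ν` is obtained from `A_{|ν|}` by applying the involution `x_i ↦ -x_i - β_i` for every
`i` with `ν_i = -1`. -/
def racahA (j : ℕ) (β x : ℕ → ℝ) (ν : Fin j → SignType) : ℝ :=
  let S : Finset (Fin j) := Finset.univ.filter fun i => ν i ≠ 0
  let B : Fin j → ℝ := fun i => β (i + 1)
  let X : Fin j → ℝ := fun i => if ν i = -1 then -x (i + 1) - β (i + 1) else x (i + 1)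
  -- the only element `i` of the first index set is the least element of `S`
  (∏ i ∈ S.filter (fun i => ∀ k ∈ S, i ≤ k), (X i + B i - β 0) * (X i + B i)) *
  -- pairs of consecutive elements of `S`
  (∏ q ∈ (S ×ˢ S).filter (fun q => q.1 < q.2 ∧ ∀ m ∈ S, ¬(q.1 < m ∧ m < q.2)),
    (X q.2 + X q.1 + B q.2) * (X q.2 + X q.1 + B q.2 + 1)) /
  (∏ i ∈ S, (2 * X i + B i) * (2 * X i + B i + 1)) *
  -- the only element `i` of the last index set is the greatest element of `S`
  (∏ i ∈ S.filter (fun i => ∀ k ∈ S, k ≤ i), (X i + β (j + 1) + x (j + 1)) * (x (j + 1) - X i))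

/-- `𝔟(β₀) = β₀` and `𝔟(β_k) = β₀ - β_{p+2-k} - 2N + 1` for `1 ≤ k ≤ p + 1`. -/
def dualParam (p : ℕ) (β : ℕ → ℝ) (N : ℝ) (k : ℕ) : ℝ :=
  if k = 0 then β 0 else β 0 - β (p + 2 - k) - 2 * N + 1

/-- `𝔟(x_k) = n₁ + ⋯ + n_{p+1-k} + β_{p+2-k} - β₀ + N - 1` for `1 ≤ k ≤ p`, and
`𝔟(x_{p+1}) = 𝔟(N) = N`. -/
def dualVar {p : ℕ} (β : ℕ → ℝ) (N : ℝ) (n : Fin p → ℤ) (k : ℕ) : ℝ :=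
  if k ≤ p then psum (fun i => (n i : ℝ)) (p + 1 - k) + β (p + 2 - k) - β 0 + N - 1 else N

/-- The translation vector of `𝔟(E_{x_k}) = E_{n_{p+1-k}} E_{n_{p+2-k}}⁻¹` for `1 ≤ k ≤ p`, with
`E_{n_{p+1}} = 1`. (The entry `i : Fin p` belongs to the variable `n_{i+1}`.) -/
def dualShift (p k : ℕ) : Fin p → ℤ := fun i =>
  (if (i : ℕ) + 1 = p + 1 - k then 1 else 0) - (if (i : ℕ) + 1 = p + 2 - k then 1 else 0)

/-- The translation operator `F ↦ F(· + v)`. -/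
def translate {p : ℕ} (v : Fin p → ℤ) : Module.End ℝ ((Fin p → ℤ) → ℝ) :=
  LinearMap.funLeft ℝ ℝ fun n => n + v

/-- For the translation `E` by `v`: the forward difference `E - 1` if `s = 1`, the backward
difference `1 - E⁻¹` if `s = -1`, the identity if `s = 0`. -/
def diffOp {p : ℕ} (v : Fin p → ℤ) (s : SignType) : Module.End ℝ ((Fin p → ℤ) → ℝ) :=
  if s = 1 then translate v - 1 else if s = -1 then 1 - translate (-v) else 1

/-- The dual Racah operator `𝔏^n_j = 𝔟(𝔏^x_j)`, where
`𝔏^x_j = ℒ_j(x₁, …, x_j; β₀, …, β_{j+1}; x_{j+1})`, acting on functions on `ℤ^p`. -/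
def racahDualOp {p : ℕ} (j : ℕ) (β : ℕ → ℝ) (N : ℝ) (F : (Fin p → ℤ) → ℝ) (n : Fin p → ℤ) : ℝ :=
  ∑ ν ∈ (Finset.univ : Finset (Fin j → SignType)).filter (fun ν => ν ≠ 0),
    (-1) ^ (Finset.univ.filter fun i => ν i = -1).card *
      racahA j (dualParam p β N) (dualVar β N n) ν *
      (List.ofFn fun i : Fin j => diffOp (dualShift p (i + 1)) (ν i)).prod F n

/-! ### The operators in `n` for the Hahn polynomials -/

/-- The Racah parameters `β_k = β₀ + γ₁ + ⋯ + γ_k + k`. -/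
def hahnParam {p : ℕ} (γ : Fin (p + 1) → ℝ) (β₀ : ℝ) (k : ℕ) : ℝ := β₀ + psum γ k + k

/-- `𝔏̃^n_j = lim_{β₀ → ∞} 𝔏^n_j / β₀`, with `𝔏^n_j` written in terms of `β₀, γ, N`. -/
def hahnOpN {p : ℕ} (j : ℕ) (γ : Fin (p + 1) → ℝ) (N : ℝ) (F : (Fin p → ℤ) → ℝ)
    (n : Fin p → ℤ) : ℝ :=
  limUnder atTop fun β₀ : ℝ => racahDualOp j (hahnParam γ β₀) N F n / β₀

/-- The parameters `(γ, N)` for which, at the point `n`, everything in the equation for `𝔏̃^n_j` is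
defined: the polynomials `H_p(n';y;γ;N)` with `|n'| ≤ |n| + 1`, and the coefficients of `𝔏̃^n_j`,
whose denominators are products of factors `z_m` and `z_m ± 1` with
`z_m = 2(n₁ + ⋯ + n_m) + γ₁ + ⋯ + γ_{m+1} + m`, `p + 1 - j ≤ m ≤ p`. -/
def Regular {p : ℕ} (j : ℕ) (n : Fin p → ℕ) (γ : Fin (p + 1) → ℝ) (N : ℝ) : Prop :=
  poch (-N) ((∑ i, n i) + 1) ≠ 0 ∧
  (∀ k : Fin p, poch (γ k.succ + 1) ((∑ i, n i) + 1) ≠ 0) ∧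
  ∀ m : ℕ, p + 1 - j ≤ m → m ≤ p →
    2 * psum (fun i => (n i : ℝ)) m + psum γ (m + 1) + m ≠ -1 ∧
    2 * psum (fun i => (n i : ℝ)) m + psum γ (m + 1) + m ≠ 0 ∧
    2 * psum (fun i => (n i : ℝ)) m + psum γ (m + 1) + m ≠ 1

end Hahn

end

noncomputable section

namespace Hahn

/-! Both equations propagate identities for the one-variable polynomials `hahn1` along the product
that defines `hahnH`.

The equation in `y`. A factor counted from 0 by `k ≥ j` sees only partial sums of `y` that contain
all of the first `j + 1` coordinates, so shifts that move one unit among these coordinates leave it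
fixed. For the first `j` factors one inducts on `j` (`hahnProd_eigen`). The terms that do not touch
the new coordinate are covered by the induction hypothesis. The others collect into one-sided sums,
evaluated by `hahnProd_minus` and `hahnProd_plus`, and what remains is the second-order difference
equation `hahn1_eigen` of the last factor.

The equation in `n`. After the substitution, `β₀` enters only the weight of the first index in the
support of `ν`, and affinely, so the limit is the coefficient of `β₀` (`racahDualOp_eq`). In the
coordinates `T_i = N_1^{p-i}` the Racah involution becomes `T_i ↦ -T_i - g_i`. Since the weight of
`ν` factors along the chain of its support, the sum over all `ν` can be computed by splitting off
the last entry again and again (`sum_ne_zero_eq_chainOp`).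

The weight attached to the last index of a chain is always a quadratic polynomial in one quantity
`t`. When the coefficient denominators are nonzero, three functionals per level therefore suffice:
the pair weights with the values `T_r` and `-T_r - g_r`, and the end weight. Expanding in this basis
gives the closed recursions `levelTail_succ` and `levelOp_succ_end`. On a product of Hahn
polynomials whose next partial sum is shifted by `1`, `-1` or `0`, respectively, one step of these
recursions is exactly a three-term relation for a single factor (`hahnN_three_term_raise`,
`hahnN_three_term_lower`, `hahnN_three_term`). The induction is `levelOp_of_isProductForm`; each
level adds `Y r - Y (r + 1)` to the eigenvalue, and the sum telescopes from `Y 0 = N`.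

At parameters that are not regular, continuity of the right-hand side gives the limit statement. -/

theorem poch_zero (x : ℝ) : poch x 0 = 1 := by simp [poch]

theorem poch_succ (x : ℝ) (k : ℕ) : poch x (k + 1) = poch x k * (x + k) := by
  simp [poch, ascPochhammer_succ_eval]

theorem poch_succ_left (x : ℝ) (k : ℕ) : poch x (k + 1) = x * poch (x + 1) k := by
  simp [poch, ascPochhammer_succ_left, Polynomial.eval_comp]

theorem poch_shift (x : ℝ) (k : ℕ) : x * poch (x + 1) k = poch x k * (x + k) := by
  rw [← poch_succ, poch_succ_left]

theorem continuous_poch (k : ℕ) : Continuous fun x : ℝ => poch x k :=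
  (ascPochhammer ℝ k).continuous

/-! ### One-variable Hahn polynomials: difference equation and contiguous relations -/

/-- The coefficient of `(-x)_k` in `hahn1 n x a b M`. -/
def hahnCoeff (n k : ℕ) (a b M : ℝ) : ℝ :=
  poch (-(n : ℝ)) k * poch (n + a + b + 1) k / (k.factorial : ℝ) *
    (poch (a + 1 + k) (n - k) * poch (-M + k) (n - k))

theorem hahn1_eq_sum (n : ℕ) (x a b M : ℝ) :
    hahn1 n x a b M = ∑ k ∈ Finset.range (n + 1), hahnCoeff n k a b M * poch (-x) k := by
  refine Finset.sum_congr rfl fun k _ => ?_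
  rw [hahnCoeff]; ring

theorem hahn1_zero (x a b M : ℝ) : hahn1 0 x a b M = 1 := by
  simp [hahn1, poch_zero]

theorem hahnCoeff_add (d k : ℕ) (a b M : ℝ) :
    hahnCoeff (k + d) k a b M = poch (-(k : ℝ) - d) k * poch (k + d + a + b + 1) k /
      (k.factorial : ℝ) * (poch (a + 1 + k) d * poch (-M + k) d) := by
  rw [hahnCoeff, Nat.add_sub_cancel_left]
  push_cast
  rw [show (-((k : ℝ) + d)) = -(k : ℝ) - d by ring]

theorem hahnCoeff_self (n : ℕ) (a b M : ℝ) :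
    hahnCoeff n n a b M = poch (-(n : ℝ)) n * poch (n + a + b + 1) n / (n.factorial : ℝ) := by
  simp [hahnCoeff, poch_zero]

/-- The recurrence of the coefficients in `k`. -/
theorem hahnCoeff_succ (n k : ℕ) (hk : k < n) (a b M : ℝ) :
    (k + 1) * (k + 1 + a) * (-M + k) * hahnCoeff n (k + 1) a b M =
      (k - n) * (n + a + b + 1 + k) * hahnCoeff n k a b M := by
  obtain ⟨d, rfl⟩ : ∃ d, n = k + 1 + d := Nat.exists_eq_add_of_le hk
  have h : hahnCoeff (k + 1 + d) k a b M = hahnCoeff (k + (d + 1)) k a b M := by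
    congr 1; omega
  rw [h, hahnCoeff_add, hahnCoeff_add, poch_succ _ k, poch_succ _ k, Nat.factorial_succ,
    poch_succ_left _ d, poch_succ_left _ d]
  push_cast
  have hf : (k.factorial : ℝ) ≠ 0 := by positivity
  have hk' : (k : ℝ) + 1 ≠ 0 := by positivity
  rw [show -((k : ℝ) + 1) - d = -k - (d + 1) by ring,
    show (k : ℝ) + 1 + d + a + b + 1 = k + (d + 1) + a + b + 1 by ring,
    show a + 1 + ((k : ℝ) + 1) = a + 1 + k + 1 by ring,
    show -M + ((k : ℝ) + 1) = -M + k + 1 by ring]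
  field_simp
  ring

/-- Holds separately for each coefficient in the expansion over `(-x)_k`: only the Pochhammer
symbols in `-x` and in `-M + k` move, and `poch_shift` handles each of them. -/
theorem hahn1_minus (n : ℕ) (x a b M : ℝ) :
    x * hahn1 n (x - 1) a b (M - 1) + (M - x) * hahn1 n x a b (M - 1) =
      (M - n) * hahn1 n x a b M := by
  simp only [hahn1_eq_sum, Finset.mul_sum, ← Finset.sum_add_distrib]
  refine Finset.sum_congr rfl fun k hk => ?_
  obtain ⟨d, rfl⟩ : ∃ d, n = k + d :=
    Nat.exists_eq_add_of_le (Nat.lt_succ_iff.mp (Finset.mem_range.mp hk))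
  rw [hahnCoeff_add, hahnCoeff_add]
  have h1 := poch_shift (-x) k
  have h2 := poch_shift (-M + k) d
  rw [show -(M - 1) + (k : ℝ) = -M + k + 1 by ring, show -(x - 1) = -x + 1 by ring]
  push_cast
  generalize poch (-(k : ℝ) - d) k * poch (k + d + a + b + 1) k / (k.factorial : ℝ) = P
  linear_combination (-P * poch (a + 1 + k) d * poch (-M + k + 1) d) * h1 -
    P * poch (a + 1 + k) d * poch (-x) k * h2

/-- The operator maps `(-x)_k` to a combination of `(-x)_k` and `(-x)_{k-1}`, and `hahnCoeff_succ`
makes consecutive contributions cancel. The sum truncated at `r` thus misses the equation by a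
single multiple of `(-x)_r`, whose factor `r - n` vanishes at `r = n`. -/
theorem hahn1_eigen (n : ℕ) (x a b M : ℝ) :
    (x + a + 1) * (M - x) * (hahn1 n (x + 1) a b M - hahn1 n x a b M) +
      x * (M - x + b + 1) * (hahn1 n (x - 1) a b M - hahn1 n x a b M) =
      -(n * (n + a + b + 1)) * hahn1 n x a b M := by
  have key : ∀ r : ℕ, r ≤ n →
      (x + a + 1) * (M - x) * (∑ k ∈ Finset.range (r + 1), hahnCoeff n k a b M * poch (-(x + 1)) k -
          ∑ k ∈ Finset.range (r + 1), hahnCoeff n k a b M * poch (-x) k) +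
      x * (M - x + b + 1) * (∑ k ∈ Finset.range (r + 1), hahnCoeff n k a b M * poch (-(x - 1)) k -
          ∑ k ∈ Finset.range (r + 1), hahnCoeff n k a b M * poch (-x) k) +
      (n * (n + a + b + 1)) * ∑ k ∈ Finset.range (r + 1), hahnCoeff n k a b M * poch (-x) k =
      - ((r - n) * (n + a + b + 1 + r) * hahnCoeff n r a b M) * poch (-x) r := by
    intro r
    induction r with
    | zero => intro _; simp [poch_zero]
    | succ r ih =>
      intro hr
      have ih := ih (by omega)
      rw [Finset.sum_range_succ _ (r + 1), Finset.sum_range_succ _ (r + 1),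
        Finset.sum_range_succ _ (r + 1)]
      rw [← hahnCoeff_succ n r (by omega)] at ih
      have h1 := poch_shift (-x) r
      have e1 : poch (-(x + 1)) (r + 1) = -(x + 1) * poch (-x) r := by
        rw [poch_succ_left]; ring_nf
      have e2 : poch (-(x - 1)) (r + 1) = poch (-x + 1) r * (-x + 1 + r) := by
        rw [poch_succ]; ring_nf
      rw [e1, e2, poch_succ (-x)]
      push_cast at ih ⊢
      linear_combination ih - (M - x + b + 1) * hahnCoeff n (r + 1) a b M * (-x + 1 + r) * h1
  have := key n le_rfl
  rw [← hahn1_eq_sum, ← hahn1_eq_sum, ← hahn1_eq_sum] at this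
  linear_combination this

theorem continuous_hahn1 {α : Type*} [TopologicalSpace α] (n : ℕ) {x a b M : α → ℝ}
    (hx : Continuous x) (ha : Continuous a) (hb : Continuous b) (hM : Continuous M) :
    Continuous fun q => hahn1 n (x q) (a q) (b q) (M q) := by
  unfold hahn1
  refine continuous_finsetSum _ fun k _ => ?_
  have h := fun (i : ℕ) (f : α → ℝ) (hf : Continuous f) => (continuous_poch i).comp hf
  simp only [Function.comp_def] at h
  refine Continuous.mul (Continuous.div_const ((continuous_const.mul (h _ _ ?_)).mul (h _ _ ?_)) _)
    ((h _ _ ?_).mul (h _ _ ?_)) <;> fun_prop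

/-- Applying `hahn1_minus` at `(x + 1, M + 1)` and `(x, M + 1)` turns the left side, multiplied by
`M + 1 - n`, into the difference equation `hahn1_eigen`. The factor is cancelled for `M ≠ n - 1`,
and the remaining value of `M` follows by continuity, this set being dense. -/
theorem hahn1_plus (n : ℕ) (x a b M : ℝ) :
    (x + a + 1) * hahn1 n (x + 1) a b (M + 1) + (M - x + b + 1) * hahn1 n x a b (M + 1) =
      (M + n + a + b + 2) * hahn1 n x a b M := by
  have hd : Dense ({(n : ℝ) - 1}ᶜ : Set ℝ) := dense_compl_singleton _
  have hc : Continuous fun M => hahn1 n x a b M :=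
    continuous_hahn1 n continuous_const continuous_const continuous_const continuous_id
  have hc1 : Continuous fun M => hahn1 n x a b (M + 1) :=
    hc.comp (continuous_id.add continuous_const)
  have hc2 : Continuous fun M => hahn1 n (x + 1) a b (M + 1) :=
    continuous_hahn1 n continuous_const continuous_const continuous_const
      (continuous_id.add continuous_const)
  refine congrFun (Continuous.ext_on hd (f := fun M => (x + a + 1) * hahn1 n (x + 1) a b (M + 1) +
    (M - x + b + 1) * hahn1 n x a b (M + 1)) (g := fun M => (M + n + a + b + 2) * hahn1 n x a b M)
    (by fun_prop) (by fun_prop) fun M hM => ?_) M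
  have hM' : M + 1 - n ≠ 0 := fun h => hM (by simp; linarith)
  have h1 := hahn1_minus n (x + 1) a b (M + 1)
  have h2 := hahn1_minus n x a b (M + 1)
  have h3 := hahn1_eigen n x a b M
  simp only [add_sub_cancel_right] at h1 h2
  apply mul_left_cancel₀ hM'
  linear_combination -(x + a + 1) * h1 - (M - x + b + 1) * h2 + h3

/-- Comparison of coefficients of `(-x)_k`. The top index `k = n + 1` is separate because the degree
`n` polynomial has no such term. -/
theorem hahn1_raise_a (n : ℕ) (x a b M : ℝ) :
    (2 * n + a + b + 3) * hahn1 (n + 1) x a b M =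
      (n + a + b + 2) * hahn1 (n + 1) x (a + 1) b M +
        (n + 1) * (n + 1 + b) * (M - n) * hahn1 n x (a + 1) b M := by
  simp only [hahn1_eq_sum]
  have split : ∀ {A B C D E : ℝ}, A = C + E → B = D → A + B = C + D + E := by
    intro A B C D E h h'
    rw [h, h']; ring
  rw [Finset.sum_range_succ _ (n + 1), Finset.sum_range_succ _ (n + 1), mul_add, mul_add,
    Finset.mul_sum, Finset.mul_sum, Finset.mul_sum]
  refine split ?_ ?_
  rw [← Finset.sum_add_distrib]
  · refine Finset.sum_congr rfl fun k hk => ?_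
    obtain ⟨d, rfl⟩ : ∃ d, n = k + d :=
      Nat.exists_eq_add_of_le (Nat.lt_succ_iff.mp (Finset.mem_range.mp hk))
    rw [add_assoc k d 1, hahnCoeff_add, hahnCoeff_add, hahnCoeff_add]
    have h1 := poch_shift (-(k : ℝ) - (d + 1)) k
    have h2 := poch_shift (k + (d + 1) + a + b + 1) k
    push_cast
    rw [poch_succ_left (a + 1 + k) d, poch_succ (-M + k) d, poch_succ (a + 1 + 1 + k) d,
      show a + 1 + (k : ℝ) + 1 = a + 1 + 1 + k by ring,
      show (k : ℝ) + (d + 1) + (a + 1) + b + 1 = k + (d + 1) + a + b + 1 + 1 by ring,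
      show (k : ℝ) + d + (a + 1) + b + 1 = k + (d + 1) + a + b + 1 by ring,
      show -(k : ℝ) - d = -k - (d + 1) + 1 by ring]
    generalize poch (-(k : ℝ) - (d + 1)) k = P at *
    generalize poch (-(k : ℝ) - (d + 1) + 1) k = P' at *
    generalize poch (k + (d + 1) + a + b + 1) k = Q at *
    generalize poch (k + (d + 1) + a + b + 1 + 1) k = Q' at *
    generalize poch (a + 1 + 1 + k) d = A
    generalize poch (-M + k) d = B
    have hf : (k.factorial : ℝ) ≠ 0 := by positivity
    field_simp
    linear_combination (-(P * A * B * poch (-x) k * (a + 2 + k + d) * (k + d - M))) * h2 +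
      ((k + d + 1 + b) * (M - k - d) * Q * A * B * poch (-x) k) * h1
  · rw [hahnCoeff_self, hahnCoeff_self]
    have h2 := poch_shift (n + 1 + a + b + 1) (n + 1)
    push_cast at *
    rw [show (n : ℝ) + 1 + (a + 1) + b + 1 = n + 1 + a + b + 1 + 1 by ring]
    linear_combination (-(poch (-((n : ℝ) + 1)) (n + 1) / ((n + 1).factorial : ℝ) *
      poch (-x) (n + 1))) * h2

/-- Multiplication by `x` sends `(-x)_k` to `k (-x)_k - (-x)_{k+1}`, so sums truncated at `r` leave
one boundary term in `(-x)_{r+1}`. At `r = n` it is the leading term of the polynomial of degree `n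
+ 1`. -/
theorem hahn1_lower_a (n : ℕ) (x a b M : ℝ) :
    (2 * n + a + b + 1) * (x + a) * hahn1 n x a b M =
      hahn1 (n + 1) x (a - 1) b M + (a + n) * (M + n + a + b + 1) * hahn1 n x (a - 1) b M := by
  have key : ∀ r : ℕ, r ≤ n →
      (2 * n + a + b + 1) * (x + a) *
          ∑ k ∈ Finset.range (r + 1), hahnCoeff n k a b M * poch (-x) k -
        ∑ k ∈ Finset.range (r + 1), hahnCoeff (n + 1) k (a - 1) b M * poch (-x) k -
        (a + n) * (M + n + a + b + 1) *
          ∑ k ∈ Finset.range (r + 1), hahnCoeff n k (a - 1) b M * poch (-x) k =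
      -((2 * n + a + b + 1) * hahnCoeff n r a b M) * poch (-x) (r + 1) := by
    intro r
    induction r with
    | zero =>
      intro _
      have h1 := poch_succ (-M) n
      have h2 := poch_succ_left a n
      have h3 := poch_succ a n
      simp only [zero_add, Finset.sum_range_one, hahnCoeff, poch_zero, Nat.sub_zero, h1, h2,
        poch_succ (-x) 0, Nat.factorial_zero, Nat.cast_zero, Nat.cast_one, sub_add_cancel, add_zero]
      linear_combination (-(M + n + a + b + 1) * poch (-M) n) * (h3.symm.trans h2)
    | succ j ih =>
      intro hj
      have ih := ih (by omega)
      rw [Finset.sum_range_succ _ (j + 1), Finset.sum_range_succ _ (j + 1),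
        Finset.sum_range_succ _ (j + 1), poch_succ (-x) (j + 1)]
      suffices h : (2 * n + a + b + 1) * ((a + (j + 1)) * hahnCoeff n (j + 1) a b M -
          hahnCoeff n j a b M) = hahnCoeff (n + 1) (j + 1) (a - 1) b M +
            (a + n) * (M + n + a + b + 1) * hahnCoeff n (j + 1) (a - 1) b M by
        push_cast
        linear_combination ih + poch (-x) (j + 1) * h
      obtain ⟨d, rfl⟩ : ∃ d, n = j + 1 + d := Nat.exists_eq_add_of_le hj
      have e : hahnCoeff (j + 1 + d) j a b M = hahnCoeff (j + (d + 1)) j a b M := by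
        congr 1; omega
      rw [e, add_assoc (j + 1) d 1, hahnCoeff_add, hahnCoeff_add, hahnCoeff_add, hahnCoeff_add]
      push_cast
      rw [show -((j : ℝ) + 1) - d = -j - (d + 1) by ring,
        show -((j : ℝ) + 1) - (d + 1) = -j - (d + 1) - 1 by ring,
        show (j : ℝ) + 1 + d + a + b + 1 = j + (d + 1) + a + b + 1 by ring,
        show (j : ℝ) + 1 + (d + 1) + (a - 1) + b + 1 = j + (d + 1) + a + b + 1 by ring,
        show (j : ℝ) + 1 + d + (a - 1) + b + 1 = j + (d + 1) + a + b by ring,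
        show a - 1 + 1 + ((j : ℝ) + 1) = a + 1 + j by ring,
        show a + 1 + ((j : ℝ) + 1) = a + 1 + j + 1 by ring,
        show -M + ((j : ℝ) + 1) = -M + j + 1 by ring,
        poch_succ (-j - (d + 1)) j, poch_succ (j + (d + 1) + a + b + 1) j,
        poch_succ_left (-j - (d + 1) - 1) j, poch_succ_left (j + (d + 1) + a + b) j,
        poch_succ_left (a + 1 + j) d, poch_succ_left (-M + j) d, poch_succ (-M + j + 1) d,
        Nat.factorial_succ]
      have hA := poch_shift (a + 1 + j) d
      rw [show -(j : ℝ) - (d + 1) - 1 + 1 = -j - (d + 1) by ring]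
      generalize poch (-(j : ℝ) - (d + 1)) j = P at *
      generalize poch (j + (d + 1) + a + b + 1) j = Q at *
      generalize poch (a + 1 + j + 1) d = A at *
      generalize poch (a + 1 + j) d = A' at *
      generalize poch (-M + j + 1) d = B
      have hf : (j.factorial : ℝ) ≠ 0 := by positivity
      have hj' : (j : ℝ) + 1 ≠ 0 := by positivity
      push_cast
      field_simp
      linear_combination (-(P * (d + 1) * (j + d + 1 + a + b) * Q * B *
        (M + (j + 1 + d) + a + b + 1))) * hA
  have h := key n le_rfl
  have e1 : hahnCoeff (n + 1) (n + 1) (a - 1) b M = -(2 * n + a + b + 1) * hahnCoeff n n a b M := by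
    rw [hahnCoeff_self, hahnCoeff_self, poch_succ_left, poch_succ, Nat.factorial_succ]
    push_cast
    rw [show -((n : ℝ) + 1) + 1 = -n by ring,
      show (n : ℝ) + 1 + (a - 1) + b + 1 = n + a + b + 1 by ring]
    have hf : (n.factorial : ℝ) ≠ 0 := by positivity
    have hj' : (n : ℝ) + 1 ≠ 0 := by positivity
    field_simp
    ring
  rw [hahn1_eq_sum, hahn1_eq_sum, hahn1_eq_sum, Finset.sum_range_succ _ (n + 1), e1]
  linear_combination h

/-- Since `(x + 1) (-x)_k = -(-(x+1))_{k+1}`, both sides are expansions in the basis `(-(x+1))_k`,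
with the index on the left one lower; hence the ranges `r` and `r + 1` in `key`. -/
theorem hahn1_lower_a_shift (n : ℕ) (x a b M : ℝ) :
    (2 * n + a + b + 1) * (x + 1) * hahn1 n x a b M =
      hahn1 (n + 1) (x + 1) (a - 1) b (M + 1) +
        (a + n) * (M - n + 1) * hahn1 n (x + 1) (a - 1) b (M + 1) := by
  have key : ∀ r : ℕ, r ≤ n →
      (2 * n + a + b + 1) * (x + 1) *
          ∑ k ∈ Finset.range r, hahnCoeff n k a b M * poch (-x) k =
        ∑ k ∈ Finset.range (r + 1), hahnCoeff (n + 1) k (a - 1) b (M + 1) * poch (-(x + 1)) k +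
        (a + n) * (M - n + 1) *
          ∑ k ∈ Finset.range (r + 1), hahnCoeff n k (a - 1) b (M + 1) * poch (-(x + 1)) k := by
    intro r
    induction r with
    | zero =>
      intro _
      have h1 := poch_succ (-(M + 1)) n
      have h3 := poch_succ a n
      simp only [zero_add, Finset.sum_range_one, hahnCoeff, poch_zero, Nat.sub_zero, h1, h3,
        Nat.factorial_zero, Nat.cast_zero, Nat.cast_one, sub_add_cancel, add_zero,
        Finset.range_zero, Finset.sum_empty]
      ring
    | succ j ih =>
      intro hj
      have ih := ih (by omega)
      rw [Finset.sum_range_succ _ (j + 1), Finset.sum_range_succ _ j,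
        Finset.sum_range_succ _ (j + 1), mul_add, ih, poch_succ_left (-(x + 1)) j]
      suffices h : -((2 * n + a + b + 1) * hahnCoeff n j a b M) =
          hahnCoeff (n + 1) (j + 1) (a - 1) b (M + 1) +
            (a + n) * (M - n + 1) * hahnCoeff n (j + 1) (a - 1) b (M + 1) by
        rw [show -(x + 1) + 1 = -x by ring]
        linear_combination -(x + 1) * poch (-x) j * h
      obtain ⟨d, rfl⟩ : ∃ d, n = j + 1 + d := Nat.exists_eq_add_of_le hj
      have e : hahnCoeff (j + 1 + d) j a b M = hahnCoeff (j + (d + 1)) j a b M := by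
        congr 1; omega
      rw [e, add_assoc (j + 1) d 1, hahnCoeff_add, hahnCoeff_add, hahnCoeff_add]
      push_cast
      rw [show -((j : ℝ) + 1) - d = -j - (d + 1) by ring,
        show -((j : ℝ) + 1) - (d + 1) = -j - (d + 1) - 1 by ring,
        show (j : ℝ) + 1 + (d + 1) + (a - 1) + b + 1 = j + (d + 1) + a + b + 1 by ring,
        show (j : ℝ) + 1 + d + (a - 1) + b + 1 = j + (d + 1) + a + b by ring,
        show a - 1 + 1 + ((j : ℝ) + 1) = a + 1 + j by ring,
        show -(M + 1) + ((j : ℝ) + 1) = -M + j by ring,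
        poch_succ (-j - (d + 1)) j, poch_succ (j + (d + 1) + a + b + 1) j,
        poch_succ_left (-j - (d + 1) - 1) j, poch_succ_left (j + (d + 1) + a + b) j,
        poch_succ_left (a + 1 + j) d, poch_succ_left (-M + j) d,
        Nat.factorial_succ]
      have hA := poch_shift (a + 1 + j) d
      have hB := poch_shift (-M + j) d
      rw [show -(j : ℝ) - (d + 1) - 1 + 1 = -j - (d + 1) by ring]
      generalize poch (-(j : ℝ) - (d + 1)) j = P at *
      generalize poch (j + (d + 1) + a + b + 1) j = Q at *
      generalize poch (a + 1 + j + 1) d = A at *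
      generalize poch (a + 1 + j) d = A' at *
      generalize poch (-M + j + 1) d = B at *
      generalize poch (-M + j) d = B' at *
      have hf : (j.factorial : ℝ) ≠ 0 := by positivity
      have hj' : (j : ℝ) + 1 ≠ 0 := by positivity
      push_cast
      field_simp
      linear_combination (-(P * (d + 1) * (j + d + 1 + a + b) * Q)) *
        ((M - j - d) * B' * hA - (a + 1 + j) * A * hB)
  have h := key n le_rfl
  have e1 : hahnCoeff (n + 1) (n + 1) (a - 1) b (M + 1) =
      -(2 * n + a + b + 1) * hahnCoeff n n a b M := by
    rw [hahnCoeff_self, hahnCoeff_self, poch_succ_left, poch_succ, Nat.factorial_succ]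
    push_cast
    rw [show -((n : ℝ) + 1) + 1 = -n by ring,
      show (n : ℝ) + 1 + (a - 1) + b + 1 = n + a + b + 1 by ring]
    have hf : (n.factorial : ℝ) ≠ 0 := by positivity
    have hj' : (n : ℝ) + 1 ≠ 0 := by positivity
    field_simp
    ring
  rw [hahn1_eq_sum, hahn1_eq_sum, hahn1_eq_sum, Finset.sum_range_succ _ (n + 1), e1,
    Finset.sum_range_succ _ n, poch_succ_left (-(x + 1)) n, show -(x + 1) + 1 = -x by ring]
  linear_combination h

/-- The change of basis is `(-x)_{k+1} = (-(x-1))_{k+1} - (k+1) (-(x-1))_k`. The first part is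
carried along as the boundary term of the truncated sums; the second combines with the previous
boundary term. -/
theorem hahn1_raise_a_shift (n : ℕ) (x a b M : ℝ) :
    (2 * n + a + b + 3) * hahn1 (n + 1) x a b M =
      (n + a + b + 2) * hahn1 (n + 1) (x - 1) (a + 1) b (M - 1) +
        (n + 1) * (n + 1 + b) * (M + n + a + b + 2) * hahn1 n (x - 1) (a + 1) b (M - 1) := by
  have key : ∀ r : ℕ, r ≤ n + 1 →
      (2 * n + a + b + 3) * ∑ k ∈ Finset.range (r + 1), hahnCoeff (n + 1) k a b M * poch (-x) k =
        (n + a + b + 2) * ∑ k ∈ Finset.range r,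
          hahnCoeff (n + 1) k (a + 1) b (M - 1) * poch (-(x - 1)) k +
        (n + 1) * (n + 1 + b) * (M + n + a + b + 2) * ∑ k ∈ Finset.range r,
          hahnCoeff n k (a + 1) b (M - 1) * poch (-(x - 1)) k +
        (2 * n + a + b + 3) * hahnCoeff (n + 1) r a b M * poch (-(x - 1)) r := by
    intro r
    induction r with
    | zero => intro _; simp [poch_zero]
    | succ r ih =>
      intro hr
      have ih := ih (by omega)
      rw [Finset.sum_range_succ _ (r + 1), mul_add, ih, Finset.sum_range_succ _ r,
        Finset.sum_range_succ _ r, poch_succ_left (-x) r, poch_succ (-(x - 1)) r]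
      suffices h : (2 * n + a + b + 3) * (hahnCoeff (n + 1) r a b M -
          (r + 1) * hahnCoeff (n + 1) (r + 1) a b M) =
          (n + a + b + 2) * hahnCoeff (n + 1) r (a + 1) b (M - 1) +
          (n + 1) * (n + 1 + b) * (M + n + a + b + 2) * hahnCoeff n r (a + 1) b (M - 1) by
        rw [show -x + 1 = -(x - 1) by ring]
        linear_combination poch (-(x - 1)) r * h
      obtain ⟨d, rfl⟩ : ∃ d, n = r + d := Nat.exists_eq_add_of_le (by omega)
      have e : hahnCoeff (r + d + 1) (r + 1) a b M = hahnCoeff (r + 1 + d) (r + 1) a b M := by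
        congr 1; omega
      rw [e, add_assoc r d 1, hahnCoeff_add, hahnCoeff_add, hahnCoeff_add, hahnCoeff_add]
      push_cast
      rw [show -((r : ℝ) + 1) - d = -r - (d + 1) by ring,
        show -(r : ℝ) - d = -r - (d + 1) + 1 by ring,
        show (r : ℝ) + 1 + d + a + b + 1 = r + (d + 1) + a + b + 1 by ring,
        show (r : ℝ) + (d + 1) + (a + 1) + b + 1 = r + (d + 1) + a + b + 1 + 1 by ring,
        show (r : ℝ) + d + (a + 1) + b + 1 = r + (d + 1) + a + b + 1 by ring,
        show a + 1 + ((r : ℝ) + 1) = a + 1 + r + 1 by ring,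
        show a + 1 + 1 + (r : ℝ) = a + 1 + r + 1 by ring,
        show -M + ((r : ℝ) + 1) = -M + r + 1 by ring,
        show -(M - 1) + (r : ℝ) = -M + r + 1 by ring,
        poch_succ (-r - (d + 1)) r, poch_succ (r + (d + 1) + a + b + 1) r,
        poch_succ_left (a + 1 + r) d, poch_succ_left (-M + r) d,
        poch_succ (a + 1 + r + 1) d, poch_succ (-M + r + 1) d,
        Nat.factorial_succ]
      have hP := poch_shift (-r - (d + 1)) r
      have hQ := poch_shift (r + (d + 1) + a + b + 1) r
      generalize poch (-(r : ℝ) - (d + 1)) r = P at *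
      generalize poch (-(r : ℝ) - (d + 1) + 1) r = P' at *
      generalize poch (r + (d + 1) + a + b + 1) r = Q at *
      generalize poch (r + (d + 1) + a + b + 1 + 1) r = Q' at *
      generalize poch (a + 1 + r + 1) d = A at *
      generalize poch (-M + r + 1) d = B at *
      have hf : (r.factorial : ℝ) ≠ 0 := by positivity
      have hr' : (r : ℝ) + 1 ≠ 0 := by positivity
      push_cast
      field_simp
      linear_combination (-(P * A * B * (a + 2 + r + d) * (r + d + 1 - M))) * hQ +
        ((r + d + 1 + b) * (M + (r + d) + a + b + 2) * Q * A * B) * hP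
  have h := key (n + 1) le_rfl
  have e1 : (2 * n + a + b + 3) * hahnCoeff (n + 1) (n + 1) a b M =
      (n + a + b + 2) * hahnCoeff (n + 1) (n + 1) (a + 1) b (M - 1) := by
    rw [hahnCoeff_self, hahnCoeff_self]
    have h2 := poch_shift (n + 1 + a + b + 1) (n + 1)
    push_cast at *
    rw [show (n : ℝ) + 1 + (a + 1) + b + 1 = n + 1 + a + b + 1 + 1 by ring]
    linear_combination (-(poch (-((n : ℝ) + 1)) (n + 1) / ((n + 1).factorial : ℝ))) * h2
  rw [e1] at h
  rw [hahn1_eq_sum, hahn1_eq_sum, hahn1_eq_sum, Finset.sum_range_succ _ (n + 1 + 0), add_zero,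
    Finset.sum_range_succ (fun k => hahnCoeff (n + 1) k (a + 1) b (M - 1) * poch (-(x - 1)) k)]
  rw [Finset.sum_range_succ _ (n + 1)] at h
  linear_combination h

/-! ### The spectral equation in `y` -/

/-- Extension of a vector to a sequence by zeros. -/
def extend {α : Type*} [Zero α] {m : ℕ} (v : Fin m → α) (i : ℕ) : α :=
  if h : i < m then v ⟨i, h⟩ else 0

theorem extend_val {α : Type*} [Zero α] {m : ℕ} (v : Fin m → α) (i : Fin m) :
    extend v i = v i := by simp [extend]

/-- The partial sums of a sequence. -/
def seqSum {R : Type*} [AddCommMonoid R] (v : ℕ → R) (k : ℕ) : R := ∑ i ∈ Finset.range k, v i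

theorem seqSum_succ {R : Type*} [AddCommMonoid R] (v : ℕ → R) (k : ℕ) :
    seqSum v (k + 1) = seqSum v k + v k := Finset.sum_range_succ _ _

theorem psum_eq_seqSum {m : ℕ} (v : Fin m → ℝ) (k : ℕ) : psum v k = seqSum (extend v) k := by
  have h1 : psum v k = ∑ i ∈ Finset.range m, if i < k then extend v i else 0 := by
    rw [Finset.sum_range]
    simp [psum, extend_val]
  rw [h1, seqSum, ← Finset.sum_filter]
  symm
  rw [← Finset.sum_filter_add_sum_filter_not (Finset.range k) (fun i => i < m)]
  rw [Finset.sum_eq_zero (s := (Finset.range k).filter fun i => ¬ i < m), add_zero]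
  · refine Finset.sum_congr ?_ fun _ _ => rfl
    ext i; simp [and_comm]
  · intro i hi
    simp only [Finset.mem_filter] at hi
    simp [extend, hi.2]

theorem cast_psum_eq_seqSum {p : ℕ} (n : Fin p → ℕ) (k : ℕ) :
    psum (fun i => (n i : ℝ)) k = (seqSum (extend n) k : ℕ) := by
  rw [psum_eq_seqSum, seqSum, seqSum]
  push_cast
  refine Finset.sum_congr rfl fun i _ => ?_
  unfold extend
  split <;> simp

theorem seqSum_add_single (y : ℕ → ℝ) (l k : ℕ) (t : ℝ) :
    seqSum (y + Pi.single l t) k = seqSum y k + if l < k then t else 0 := by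
  simp [seqSum, Finset.sum_add_distrib, Pi.single_apply]

/-- The factor number `k` (counted from `0`) of the product in `hahnH`, for sequences. -/
def hahnFactor (n : ℕ → ℕ) (γ y : ℕ → ℝ) (k : ℕ) : ℝ :=
  hahn1 (n k) (seqSum y (k + 1) - (seqSum n k : ℕ))
    (2 * (seqSum n k : ℕ) + seqSum γ (k + 1) + k) (γ (k + 1)) (seqSum y (k + 2) - (seqSum n k : ℕ))

/-- The product of the first `j` factors in `hahnH`, for sequences. -/
def hahnProd (n : ℕ → ℕ) (γ : ℕ → ℝ) (j : ℕ) (y : ℕ → ℝ) : ℝ :=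
  ∏ k ∈ Finset.range j, hahnFactor n γ y k

theorem hahnProd_succ (n : ℕ → ℕ) (γ : ℕ → ℝ) (j : ℕ) (y : ℕ → ℝ) :
    hahnProd n γ (j + 1) y = hahnProd n γ j y * hahnFactor n γ y j :=
  Finset.prod_range_succ _ _

theorem hahnProd_add_single (n : ℕ → ℕ) (γ : ℕ → ℝ) (j : ℕ) (y : ℕ → ℝ) (t : ℝ) :
    hahnProd n γ j (y + Pi.single (j + 1) t) = hahnProd n γ j y := by
  refine Finset.prod_congr rfl fun k hk => ?_
  have hk := Finset.mem_range.mp hk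
  simp [hahnFactor, seqSum_add_single, show ¬ j + 1 < k + 1 by omega, show ¬ j + 1 < k + 2 by omega]

/-- Lowering an earlier coordinate lowers both the variable and the size of the last factor, whereas
lowering the newest one lowers only the size. After the induction hypothesis these are the two terms
of `hahn1_minus`. -/
theorem hahnProd_minus (n : ℕ → ℕ) (γ : ℕ → ℝ) (j : ℕ) (y : ℕ → ℝ) :
    ∑ m ∈ Finset.range (j + 1), y m * hahnProd n γ j (y + Pi.single m (-1)) =
      (seqSum y (j + 1) - (seqSum n j : ℕ)) * hahnProd n γ j y := by
  induction j with
  | zero => simp [hahnProd, seqSum]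
  | succ j ih =>
    rw [Finset.sum_range_succ, hahnProd_succ, hahnProd_succ, hahnProd_add_single]
    have h1 : ∀ m ∈ Finset.range (j + 1),
        y m * hahnProd n γ (j + 1) (y + Pi.single m (-1)) =
        y m * hahnProd n γ j (y + Pi.single m (-1)) *
          hahn1 (n j) (seqSum y (j + 1) - (seqSum n j : ℕ) - 1)
            (2 * (seqSum n j : ℕ) + seqSum γ (j + 1) + j) (γ (j + 1))
            (seqSum y (j + 2) - (seqSum n j : ℕ) - 1) := by
      intro m hm
      have hm := Finset.mem_range.mp hm
      rw [hahnProd_succ, ← mul_assoc, hahnFactor, seqSum_add_single, seqSum_add_single,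
        if_pos hm, if_pos (by omega)]
      congr 2 <;> ring
    rw [Finset.sum_congr rfl h1, ← Finset.sum_mul, ih, hahnFactor, hahnFactor, seqSum_add_single,
      seqSum_add_single, if_neg (by omega), if_pos (by omega), seqSum_succ n j]
    have h := hahn1_minus (n j) (seqSum y (j + 1) - (seqSum n j : ℕ))
      (2 * (seqSum n j : ℕ) + seqSum γ (j + 1) + j) (γ (j + 1))
      (seqSum y (j + 2) - (seqSum n j : ℕ))
    have hy := seqSum_succ y (j + 1)
    rw [show seqSum y (j + 1) + 0 - (seqSum n j : ℕ) = seqSum y (j + 1) - (seqSum n j : ℕ) by ring,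
      show seqSum y (j + 2) + -1 - (seqSum n j : ℕ) = seqSum y (j + 2) - (seqSum n j : ℕ) - 1 by
        ring]
    push_cast
    rw [show y (j + 1) = seqSum y (j + 2) - seqSum y (j + 1) by rw [hy]; ring]
    linear_combination hahnProd n γ j y * h

theorem hahnProd_plus (n : ℕ → ℕ) (γ : ℕ → ℝ) (j : ℕ) (y : ℕ → ℝ) :
    ∑ l ∈ Finset.range (j + 1), (y l + γ l + 1) * hahnProd n γ j (y + Pi.single l 1) =
      (seqSum y (j + 1) + (seqSum n j : ℕ) + seqSum γ (j + 1) + j + 1) * hahnProd n γ j y := by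
  induction j with
  | zero => simp [hahnProd, seqSum]
  | succ j ih =>
    rw [Finset.sum_range_succ, hahnProd_succ, hahnProd_succ, hahnProd_add_single]
    have h1 : ∀ m ∈ Finset.range (j + 1),
        (y m + γ m + 1) * hahnProd n γ (j + 1) (y + Pi.single m 1) =
        (y m + γ m + 1) * hahnProd n γ j (y + Pi.single m 1) *
          hahn1 (n j) (seqSum y (j + 1) - (seqSum n j : ℕ) + 1)
            (2 * (seqSum n j : ℕ) + seqSum γ (j + 1) + j) (γ (j + 1))
            (seqSum y (j + 2) - (seqSum n j : ℕ) + 1) := by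
      intro m hm
      have hm := Finset.mem_range.mp hm
      rw [hahnProd_succ, ← mul_assoc, hahnFactor, seqSum_add_single, seqSum_add_single,
        if_pos hm, if_pos (by omega)]
      congr 2 <;> ring
    rw [Finset.sum_congr rfl h1, ← Finset.sum_mul, ih, hahnFactor, hahnFactor, seqSum_add_single,
      seqSum_add_single, if_neg (by omega), if_pos (by omega), seqSum_succ n j]
    have h := hahn1_plus (n j) (seqSum y (j + 1) - (seqSum n j : ℕ))
      (2 * (seqSum n j : ℕ) + seqSum γ (j + 1) + j) (γ (j + 1))
      (seqSum y (j + 2) - (seqSum n j : ℕ))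
    have hy := seqSum_succ y (j + 1)
    have hγ := seqSum_succ γ (j + 1)
    rw [show seqSum y (j + 1) + 0 - (seqSum n j : ℕ) = seqSum y (j + 1) - (seqSum n j : ℕ) by ring,
      show seqSum y (j + 2) + 1 - (seqSum n j : ℕ) = seqSum y (j + 2) - (seqSum n j : ℕ) + 1 by
        ring]
    push_cast
    rw [show y (j + 1) = seqSum y (j + 2) - seqSum y (j + 1) by rw [hy]; ring, hγ]
    linear_combination hahnProd n γ j y * h

/-- The double sum splits into four blocks according to whether `l` or `m` is the new coordinate.
The old block fixes the last factor; the column and the row move its variable by `1` and `-1` at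
constant size and contain the one-sided sums of the previous product; the corner is zero. In total
this is `hahn1_eigen` for the last factor. -/
theorem hahnProd_eigen (n : ℕ → ℕ) (γ : ℕ → ℝ) (j : ℕ) (y : ℕ → ℝ) :
    ∑ l ∈ Finset.range (j + 1), ∑ m ∈ Finset.range (j + 1), (y l + γ l + 1) * y m *
        (hahnProd n γ j (y + Pi.single l 1 + Pi.single m (-1)) - hahnProd n γ j y) =
      -((seqSum n j : ℕ) * ((seqSum n j : ℕ) + j + seqSum γ (j + 1))) * hahnProd n γ j y := by
  induction j with
  | zero => simp [hahnProd, seqSum]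
  | succ j ih =>
    set x : ℝ := seqSum y (j + 1) - (seqSum n j : ℕ) with hx
    set a : ℝ := 2 * (seqSum n j : ℕ) + seqSum γ (j + 1) + j with ha
    set M : ℝ := seqSum y (j + 2) - (seqSum n j : ℕ) with hM
    set h0 : ℝ := hahn1 (n j) x a (γ (j + 1)) M with hh0
    set P : ℝ := hahnProd n γ j y with hP
    have hF : hahnProd n γ (j + 1) y = P * h0 := hahnProd_succ _ _ _ _
    have inner : ∀ l ∈ Finset.range (j + 1), ∀ m ∈ Finset.range (j + 1),
        hahnProd n γ (j + 1) (y + Pi.single l 1 + Pi.single m (-1)) =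
          hahnProd n γ j (y + Pi.single l 1 + Pi.single m (-1)) * h0 := by
      intro l hl m hm
      have hl := Finset.mem_range.mp hl
      have hm := Finset.mem_range.mp hm
      simp only [hahnProd_succ, hahnFactor, seqSum_add_single, if_pos hl, if_pos hm,
        if_pos (show l < j + 2 by omega), if_pos (show m < j + 2 by omega), add_neg_cancel_right]
      rfl
    have col : ∀ l ∈ Finset.range (j + 1),
        hahnProd n γ (j + 1) (y + Pi.single l 1 + Pi.single (j + 1) (-1)) =
          hahnProd n γ j (y + Pi.single l 1) * hahn1 (n j) (x + 1) a (γ (j + 1)) M := by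
      intro l hl
      have hl := Finset.mem_range.mp hl
      simp only [hahnProd_succ, hahnFactor, hahnProd_add_single, seqSum_add_single, if_pos hl,
        if_pos (show l < j + 2 by omega), if_pos (show j + 1 < j + 2 by omega), lt_irrefl,
        add_neg_cancel_right, if_false]
      congr 2; ring
    have row : ∀ m ∈ Finset.range (j + 1),
        hahnProd n γ (j + 1) (y + Pi.single (j + 1) 1 + Pi.single m (-1)) =
          hahnProd n γ j (y + Pi.single m (-1)) * hahn1 (n j) (x - 1) a (γ (j + 1)) M := by
      intro m hm
      have hm := Finset.mem_range.mp hm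
      rw [add_right_comm]
      simp only [hahnProd_succ, hahnFactor, hahnProd_add_single, seqSum_add_single, if_pos hm,
        if_pos (show m < j + 2 by omega), if_pos (show j + 1 < j + 2 by omega), lt_irrefl,
        neg_add_cancel_right, if_false]
      congr 2; ring
    have corner : y + Pi.single (j + 1) 1 + Pi.single (j + 1) (-1) = y := by
      rw [add_assoc, ← Pi.single_add]; simp
    simp only [Finset.sum_range_succ _ (j + 1), Finset.sum_add_distrib]
    rw [corner, sub_self, mul_zero, add_zero, hF]
    have s1 : ∑ l ∈ Finset.range (j + 1), ∑ m ∈ Finset.range (j + 1), (y l + γ l + 1) * y m *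
        (hahnProd n γ (j + 1) (y + Pi.single l 1 + Pi.single m (-1)) - P * h0) =
        (∑ l ∈ Finset.range (j + 1), ∑ m ∈ Finset.range (j + 1), (y l + γ l + 1) * y m *
        (hahnProd n γ j (y + Pi.single l 1 + Pi.single m (-1)) - P)) * h0 := by
      simp only [Finset.sum_mul]
      refine Finset.sum_congr rfl fun l hl => Finset.sum_congr rfl fun m hm => ?_
      rw [inner l hl m hm]; ring
    have s2 : ∑ l ∈ Finset.range (j + 1), (y l + γ l + 1) * y (j + 1) *
        (hahnProd n γ (j + 1) (y + Pi.single l 1 + Pi.single (j + 1) (-1)) - P * h0) =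
        y (j + 1) * ((∑ l ∈ Finset.range (j + 1), (y l + γ l + 1) *
          hahnProd n γ j (y + Pi.single l 1)) * hahn1 (n j) (x + 1) a (γ (j + 1)) M -
          (seqSum y (j + 1) + seqSum γ (j + 1) + (j + 1)) * P * h0) := by
      have : seqSum y (j + 1) + seqSum γ (j + 1) + (j + 1) =
          ∑ l ∈ Finset.range (j + 1), (y l + γ l + 1) := by
        simp [seqSum, Finset.sum_add_distrib]
      rw [this]
      simp only [Finset.sum_mul, ← Finset.sum_sub_distrib, Finset.mul_sum]
      refine Finset.sum_congr rfl fun l hl => ?_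
      rw [col l hl]; ring
    have s3 : ∑ m ∈ Finset.range (j + 1), (y (j + 1) + γ (j + 1) + 1) * y m *
        (hahnProd n γ (j + 1) (y + Pi.single (j + 1) 1 + Pi.single m (-1)) - P * h0) =
        (y (j + 1) + γ (j + 1) + 1) * ((∑ m ∈ Finset.range (j + 1), y m *
          hahnProd n γ j (y + Pi.single m (-1))) * hahn1 (n j) (x - 1) a (γ (j + 1)) M -
          seqSum y (j + 1) * P * h0) := by
      rw [show seqSum y (j + 1) = ∑ m ∈ Finset.range (j + 1), y m from rfl]
      simp only [Finset.sum_mul, ← Finset.sum_sub_distrib, Finset.mul_sum]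
      refine Finset.sum_congr rfl fun l hl => ?_
      rw [row l hl]; ring
    rw [s1, s2, s3, ih, hahnProd_minus, hahnProd_plus, seqSum_succ n j, seqSum_succ γ (j + 1)]
    have h := hahn1_eigen (n j) x a (γ (j + 1)) M
    have hy := seqSum_succ y (j + 1)
    rw [← hP, ← hx]
    have e1 : seqSum y (j + 1) = x + (seqSum n j : ℕ) := by rw [hx]; ring
    have e2 : y (j + 1) = M - x := by rw [hM, hx, hy]; ring
    have e3 : seqSum γ (j + 1) = a - 2 * (seqSum n j : ℕ) - j := by rw [ha]; ring
    rw [← hh0] at h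
    rw [e1, e2, e3]
    push_cast
    linear_combination P * h

theorem hahnH_eq_hahnProd {p : ℕ} (n : Fin p → ℕ) (y : Fin p → ℝ) (γ : Fin (p + 1) → ℝ) (N : ℝ) :
    hahnH n y γ N =
      (-1) ^ (∑ i, n i) / (poch (-N) (∑ i, n i) * ∏ k : Fin p, poch (γ k.succ + 1) (n k)) *
        hahnProd (extend n) (extend γ) p (extend (compl y N)) := by
  rw [hahnH, hahnProd, Finset.prod_range]
  congr 1
  refine Finset.prod_congr rfl fun k _ => ?_
  rw [hahnFactor, cast_psum_eq_seqSum, extend_val, psum_eq_seqSum, psum_eq_seqSum, psum_eq_seqSum]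
  congr 1
  exact (extend_val γ k.succ).symm

/-- The completed coordinate `N - |y|` changes oppositely to `|y|`, so the convention `E_{y_{p+1}} =
1` becomes a genuine unit shift of the completed vector and all coordinates play the same role. -/
theorem extend_compl_shift {p : ℕ} (y : Fin p → ℝ) (N : ℝ) (l m : Fin (p + 1)) :
    extend (compl (y + unitVec l - unitVec m) N) =
      extend (compl y N) + Pi.single (l : ℕ) 1 + Pi.single (m : ℕ) (-1) := by
  have hs : ∀ l : Fin (p + 1), ∑ i : Fin p, unitVec l i = if l = Fin.last p then 0 else 1 := by
    intro l
    induction l using Fin.lastCases with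
    | last => simp [unitVec, Fin.castSucc_ne_last]
    | cast l => simp [unitVec, Fin.castSucc_ne_last]
  ext i
  by_cases hi : i < p + 1
  · obtain ⟨i, rfl⟩ : ∃ i' : Fin (p + 1), (i' : ℕ) = i := ⟨⟨i, hi⟩, rfl⟩
    simp only [Pi.add_apply, extend_val, Pi.single_apply, Fin.val_inj]
    induction i using Fin.lastCases with
    | last =>
      simp only [compl, Fin.snoc_last, Pi.add_apply, Pi.sub_apply, Finset.sum_add_distrib,
        Finset.sum_sub_distrib, hs, eq_comm (a := Fin.last p)]
      split_ifs <;> ring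
    | cast i =>
      simp only [compl, Fin.snoc_castSucc, Pi.add_apply, Pi.sub_apply, unitVec]
      split_ifs <;> ring
  · have hl : (l : ℕ) ≠ i := by omega
    have hm : (m : ℕ) ≠ i := by omega
    simp [extend, hi, hl.symm, hm.symm]

theorem hahnOpY_hahnH {p j : ℕ} (hjp : j ≤ p) (n : Fin p → ℕ) (γ : Fin (p + 1) → ℝ) (N : ℝ)
    (y : Fin p → ℝ) :
    hahnOpY j γ N (fun y' => hahnH n y' γ N) y =
      -(psum (fun i => (n i : ℝ)) j * (psum (fun i => (n i : ℝ)) j + j + psum γ (j + 1))) *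
        hahnH n y γ N := by
  rw [cast_psum_eq_seqSum, psum_eq_seqSum]
  set z := extend (compl y N) with hz
  set C := (-1 : ℝ) ^ (∑ i, n i) / (poch (-N) (∑ i, n i) * ∏ k : Fin p, poch (γ k.succ + 1) (n k))
    with hC
  have split : ∀ v, hahnProd (extend n) (extend γ) p v = hahnProd (extend n) (extend γ) j v *
      ∏ k ∈ Finset.Ico j p, hahnFactor (extend n) (extend γ) v k := fun v =>
    (Finset.prod_range_mul_prod_Ico _ hjp).symm
  set Q := ∏ k ∈ Finset.Ico j p, hahnFactor (extend n) (extend γ) z k with hQ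
  have term : ∀ l m : Fin (p + 1),
      (if l ≠ m ∧ (l : ℕ) < j + 1 ∧ (m : ℕ) < j + 1 then
        (compl y N l + γ l + 1) * compl y N m *
          (hahnH n (y + unitVec l - unitVec m) γ N - hahnH n y γ N) else 0) =
      if (l : ℕ) < j + 1 then if (m : ℕ) < j + 1 then C * Q * ((z l + extend γ l + 1) * z m *
        (hahnProd (extend n) (extend γ) j (z + Pi.single (l : ℕ) 1 + Pi.single (m : ℕ) (-1)) -
          hahnProd (extend n) (extend γ) j z)) else 0 else 0 := by
    intro l m
    by_cases hl : (l : ℕ) < j + 1 <;> by_cases hm : (m : ℕ) < j + 1 <;> simp only [hl, hm, and_false,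
      and_true, if_true, if_false, and_self]
    -- Diagonal terms vanish because the two shifts cancel, so the condition `l ≠ m` can be dropped
    -- to reach the full double sum of `hahnProd_eigen`.
    by_cases hlm : l = m
    · subst hlm
      have hz' : z + Pi.single (l : ℕ) 1 + Pi.single (l : ℕ) (-1) = z := by
        rw [add_assoc, ← Pi.single_add]; simp
      simp [hz']
    · rw [if_pos hlm, hahnH_eq_hahnProd, hahnH_eq_hahnProd, extend_compl_shift, ← hz, ← hC, split,
        split z, ← hQ]
      have : ∏ k ∈ Finset.Ico j p, hahnFactor (extend n) (extend γ)
          (z + Pi.single (l : ℕ) 1 + Pi.single (m : ℕ) (-1)) k = Q := by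
        refine Finset.prod_congr rfl fun k hk => ?_
        have hk := (Finset.mem_Ico.mp hk).1
        simp only [hahnFactor, seqSum_add_single, if_pos (show (l : ℕ) < k + 1 by omega),
          if_pos (show (m : ℕ) < k + 1 by omega), if_pos (show (l : ℕ) < k + 2 by omega),
          if_pos (show (m : ℕ) < k + 2 by omega), add_neg_cancel_right]
      rw [this, hz, extend_val, extend_val, extend_val]
      ring
  have conv : ∀ f : ℕ → ℝ, ∑ l : Fin (p + 1), (if (l : ℕ) < j + 1 then f l else 0) =
      ∑ l ∈ Finset.range (j + 1), f l := by
    intro f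
    rw [← Finset.sum_range (fun l => if l < j + 1 then f l else 0), ← Finset.sum_filter]
    refine Finset.sum_congr ?_ fun _ _ => rfl
    ext i
    simp only [Finset.mem_filter, Finset.mem_range]
    omega
  set G : ℕ → ℕ → ℝ := fun l m => C * Q * ((z l + extend γ l + 1) * z m *
    (hahnProd (extend n) (extend γ) j (z + Pi.single l 1 + Pi.single m (-1)) -
      hahnProd (extend n) (extend γ) j z)) with hG
  have inner : ∀ l : Fin (p + 1), (∑ m : Fin (p + 1), if (l : ℕ) < j + 1 then
      if (m : ℕ) < j + 1 then G l m else 0 else 0) =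
      if (l : ℕ) < j + 1 then ∑ m ∈ Finset.range (j + 1), G l m else 0 := by
    intro l
    by_cases hl : (l : ℕ) < j + 1
    · simp only [if_pos hl]
      exact conv (G l)
    · simp [hl]
  calc hahnOpY j γ N (fun y' => hahnH n y' γ N) y
      = ∑ l : Fin (p + 1), ∑ m : Fin (p + 1), if (l : ℕ) < j + 1 then
          if (m : ℕ) < j + 1 then G l m else 0 else 0 :=
        Finset.sum_congr rfl fun l _ => Finset.sum_congr rfl fun m _ => term l m
    _ = ∑ l : Fin (p + 1), if (l : ℕ) < j + 1 then
          (∑ m ∈ Finset.range (j + 1), G l m) else 0 :=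
        Finset.sum_congr rfl fun l _ => inner l
    _ = ∑ l ∈ Finset.range (j + 1), ∑ m ∈ Finset.range (j + 1), G l m :=
        conv fun l => ∑ m ∈ Finset.range (j + 1), G l m
    _ = _ := by
      simp only [hG, ← Finset.mul_sum]
      rw [hahnProd_eigen, hahnH_eq_hahnProd, ← hz, ← hC, split z, ← hQ]
      ring

/-! ### A recursion for the Racah operators -/

/-- A product over the support of `ν` of weights `f` at the first element, `g` at the pairs of
consecutive elements, `1 / d` at all elements, and `l` at the last element. -/
def chainWeight (f : ℕ → SignType → ℝ) (g : ℕ → SignType → ℕ → SignType → ℝ)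
    (d : ℕ → SignType → ℝ) (l : ℕ → SignType → ℝ) {r : ℕ} (ν : Fin r → SignType) : ℝ :=
  (∏ i : Fin r, if ν i ≠ 0 ∧ ∀ k, ν k ≠ 0 → i ≤ k then f i (ν i) else 1) *
  (∏ i : Fin r, ∏ k : Fin r,
    if ν i ≠ 0 ∧ ν k ≠ 0 ∧ i < k ∧ ∀ m, ν m ≠ 0 → ¬(i < m ∧ m < k) then
      g i (ν i) k (ν k) else 1) /
  (∏ i : Fin r, if ν i ≠ 0 then d i (ν i) else 1) *
  (∏ i : Fin r, if ν i ≠ 0 ∧ ∀ k, ν k ≠ 0 → k ≤ i then l i (ν i) else 1)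

section chainWeight

variable (f : ℕ → SignType → ℝ) (g : ℕ → SignType → ℕ → SignType → ℝ)
    (d : ℕ → SignType → ℝ) (l : ℕ → SignType → ℝ)

theorem chainWeight_snoc_zero {r : ℕ} (ν : Fin r → SignType) :
    chainWeight f g d l (Fin.snoc ν 0 : Fin (r + 1) → SignType) = chainWeight f g d l ν := by
  simp [chainWeight, Fin.prod_univ_castSucc, Fin.forall_fin_succ']

theorem chainWeight_snoc_of_eq_zero (r : ℕ) {ε : SignType} (hε : ε ≠ 0) :
    chainWeight f g d l (Fin.snoc (0 : Fin r → SignType) ε : Fin (r + 1) → SignType) =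
      l r ε / d r ε * f r ε := by
  simp [chainWeight, Fin.prod_univ_castSucc, Fin.forall_fin_succ', hε]
  ring

/-- The new entry takes over the role of last element, so the old last element loses its weight `l`
and acquires the pair weight with the new one. That pair weight acts as the end weight of the
shorter chain. -/
theorem chainWeight_snoc {r : ℕ} {ν : Fin r → SignType} (hν : ν ≠ 0) {ε : SignType}
    (hε : ε ≠ 0) :
    chainWeight f g d l (Fin.snoc ν ε : Fin (r + 1) → SignType) =
      l r ε / d r ε * chainWeight f g d (fun i s => g i s r ε) ν := by
  have h1 : ∃ k, ν k ≠ 0 := Function.ne_iff.mp hν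
  have h2 : ¬ ∀ k, ν k = 0 := by simpa using h1
  have h4 : ∀ (c : Prop) [Decidable c] (A B : ℝ),
      (if c then A * B else A) = A * if c then B else 1 := by
    intro c _ A B
    split_ifs <;> ring
  simp [chainWeight, Fin.prod_univ_castSucc, Fin.forall_fin_succ', hε, h2, Fin.le_last,
    -not_forall, Fin.castSucc_lt_last, (Fin.castSucc_lt_last _).not_ge,
    (Fin.castSucc_lt_last _).not_gt]
  simp only [h4, Finset.prod_mul_distrib]
  ring_nf

end chainWeight

/-- For the translation by `v`, the operator `E - 1` if `s = 1` and `E⁻¹ - 1` if `s = -1`. -/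
def stepDiff {p : ℕ} (v : Fin p → ℤ) (s : SignType) (F : (Fin p → ℤ) → ℝ) : (Fin p → ℤ) → ℝ :=
  (if s = -1 then (-1 : ℝ) else 1) • diffOp v s F

theorem stepDiff_one {p : ℕ} (v : Fin p → ℤ) (F : (Fin p → ℤ) → ℝ) (n : Fin p → ℤ) :
    stepDiff v 1 F n = F (n + v) - F n := by
  simp [stepDiff, diffOp, translate, LinearMap.funLeft]

theorem stepDiff_neg_one {p : ℕ} (v : Fin p → ℤ) (F : (Fin p → ℤ) → ℝ) (n : Fin p → ℤ) :
    stepDiff v (-1) F n = F (n - v) - F n := by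
  simp [stepDiff, diffOp, translate, LinearMap.funLeft, sub_eq_add_neg]

/-- The sum over all `ν : Fin r → SignType`, `ν ≠ 0`, of the operators with coefficients
`chainWeight f g d l ν`, computed by splitting off the last entry of `ν`. -/
def chainOp {p : ℕ} (v : ℕ → Fin p → ℤ) (f : ℕ → SignType → ℝ)
    (g : ℕ → SignType → ℕ → SignType → ℝ) (d : ℕ → SignType → ℝ) (n : Fin p → ℤ) :
    (r : ℕ) → (l : ℕ → SignType → ℝ) → ((Fin p → ℤ) → ℝ) → ℝ
  | 0, _, _ => 0
  | r + 1, l, F => chainOp v f g d n r l F +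
      (l r 1 / d r 1 * (f r 1 * stepDiff (v r) 1 F n +
        chainOp v f g d n r (fun i s => g i s r 1) (stepDiff (v r) 1 F)) +
      l r (-1) / d r (-1) * (f r (-1) * stepDiff (v r) (-1) F n +
        chainOp v f g d n r (fun i s => g i s r (-1)) (stepDiff (v r) (-1) F)))

section chainOp

variable {p : ℕ} (v : ℕ → Fin p → ℤ) (f : ℕ → SignType → ℝ)
    (g : ℕ → SignType → ℕ → SignType → ℝ) (d : ℕ → SignType → ℝ) (n : Fin p → ℤ)

theorem neg_one_pow_card_snoc {r : ℕ} (ν : Fin r → SignType) (ε : SignType) :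
    (-1 : ℝ) ^ (Finset.univ.filter fun i => (Fin.snoc ν ε : Fin (r + 1) → SignType) i = -1).card =
      (if ε = -1 then (-1 : ℝ) else 1) * (-1) ^ (Finset.univ.filter fun i => ν i = -1).card := by
  have h : ∀ {m : ℕ} (μ : Fin m → SignType),
      (-1 : ℝ) ^ (Finset.univ.filter fun i => μ i = -1).card =
        ∏ i, if μ i = -1 then (-1 : ℝ) else 1 := by
    intro m μ
    rw [Finset.prod_ite]; simp
  rw [h, h, Fin.prod_univ_castSucc]
  simp [mul_comm]

theorem sum_fin_snoc {r : ℕ} (G : (Fin (r + 1) → SignType) → ℝ) :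
    ∑ ν, G ν = ∑ ν : Fin r → SignType, G (Fin.snoc ν 0) +
      (∑ ν : Fin r → SignType, G (Fin.snoc ν 1) + ∑ ν : Fin r → SignType, G (Fin.snoc ν (-1))) := by
  rw [← (Fin.snocEquiv fun _ => SignType).sum_comp, Fintype.sum_prod_type, SignType.univ_eq,
    Finset.sum_insert (by decide), Finset.sum_insert (by decide), Finset.sum_singleton,
    add_comm (Finset.sum _ _) (Finset.sum _ _)]
  rfl

/-- A transfer-matrix evaluation of the sum over all `ν`. The sign `(-1)^{|ν⁻|}` is absorbed into
`stepDiff`, which turns `1 - E⁻¹` into `E⁻¹ - 1`. -/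
theorem sum_ne_zero_eq_chainOp (r : ℕ) (l : ℕ → SignType → ℝ) (F : (Fin p → ℤ) → ℝ) :
    ∑ ν ∈ (Finset.univ : Finset (Fin r → SignType)).filter (fun ν => ν ≠ 0),
      (-1) ^ (Finset.univ.filter fun i => ν i = -1).card * chainWeight f g d l ν *
        (List.ofFn fun i : Fin r => diffOp (v i) (ν i)).prod F n =
      chainOp v f g d n r l F := by
  induction r generalizing l F with
  | zero =>
    rw [chainOp, Finset.sum_eq_zero]
    intro ν hν
    exact absurd (Subsingleton.elim ν 0) (Finset.mem_filter.mp hν).2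
  | succ r ih =>
    have hlist : ∀ (ν : Fin r → SignType) (ε : SignType),
        (List.ofFn fun i : Fin (r + 1) =>
          diffOp (v i) ((Fin.snoc ν ε : Fin (r + 1) → SignType) i)).prod F n =
        (List.ofFn fun i : Fin r => diffOp (v i) (ν i)).prod (diffOp (v r) ε F) n := by
      intro ν ε
      rw [List.ofFn_succ_last, List.prod_append]
      simp [Module.End.mul_apply]
    have hstep : ∀ ε : SignType, ε ≠ 0 →
        ∑ ν : Fin r → SignType, (if (Fin.snoc ν ε : Fin (r + 1) → SignType) ≠ 0 then
          (-1) ^ (Finset.univ.filter fun i =>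
            (Fin.snoc ν ε : Fin (r + 1) → SignType) i = -1).card *
          chainWeight f g d l (Fin.snoc ν ε : Fin (r + 1) → SignType) *
          (List.ofFn fun i : Fin (r + 1) =>
            diffOp (v i) ((Fin.snoc ν ε : Fin (r + 1) → SignType) i)).prod F n else 0) =
        l r ε / d r ε * (f r ε * stepDiff (v r) ε F n +
          chainOp v f g d n r (fun i s => g i s r ε) (stepDiff (v r) ε F)) := by
      intro ε hε
      have hne : ∀ ν : Fin r → SignType, (Fin.snoc ν ε : Fin (r + 1) → SignType) ≠ 0 := by
        intro ν h
        have := congrFun h (Fin.last r)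
        simp [hε] at this
      -- The multi-index with all earlier entries zero is isolated: there the new entry is both
      -- first and last, which yields the separate term with the weight `f`.
      rw [← ih, mul_add, Finset.sum_filter, Finset.mul_sum,
        ← Finset.add_sum_erase _ _ (Finset.mem_univ (0 : Fin r → SignType)),
        ← Finset.add_sum_erase _ (fun ν => _ * _) (Finset.mem_univ (0 : Fin r → SignType))]
      rw [if_neg (show ¬ ((0 : Fin r → SignType) ≠ 0) by simp), mul_zero, zero_add]
      congr 1
      · rw [if_pos (hne 0), neg_one_pow_card_snoc, chainWeight_snoc_of_eq_zero f g d l r hε, hlist]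
        have : ∀ G : (Fin p → ℤ) → ℝ, (List.ofFn fun i : Fin r =>
            diffOp (v i) ((0 : Fin r → SignType) i)).prod G = G := by
          intro G
          simp [diffOp]
        rw [this]
        simp [stepDiff]
        ring_nf
      · refine Finset.sum_congr rfl fun ν hν => ?_
        have hν : ν ≠ 0 := (Finset.mem_erase.mp hν).1
        rw [if_pos (hne ν), if_pos hν, neg_one_pow_card_snoc, chainWeight_snoc f g d l hν hε, hlist,
          stepDiff, map_smul, Pi.smul_apply, smul_eq_mul]
        ring
    rw [Finset.sum_filter, sum_fin_snoc, hstep 1 (by decide), hstep (-1) (by decide), chainOp, ← ih l F,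
      Finset.sum_filter]
    congr 1
    refine Finset.sum_congr rfl fun ν _ => ?_
    have h0 : (Fin.snoc ν 0 : Fin (r + 1) → SignType) ≠ 0 ↔ ν ≠ 0 := by
      rw [not_iff_not]
      simp [funext_iff, Fin.forall_fin_succ']
    rw [neg_one_pow_card_snoc, chainWeight_snoc_zero, hlist]
    simp [h0, diffOp]

theorem chainOp_add_mul_first (f₁ f₂ : ℕ → SignType → ℝ) (t : ℝ) (r : ℕ) (l : ℕ → SignType → ℝ)
    (F : (Fin p → ℤ) → ℝ) :
    chainOp v (fun i s => f₁ i s + t * f₂ i s) g d n r l F =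
      chainOp v f₁ g d n r l F + t * chainOp v f₂ g d n r l F := by
  induction r generalizing l F with
  | zero => simp [chainOp]
  | succ r ih => simp only [chainOp, ih]; ring

/-- `chainOp` is linear in the weights of the last element. -/
theorem chainOp_linear_last (r : ℕ) (l l₀ l₁ l₂ : ℕ → SignType → ℝ) (c₀ c₁ c₂ : ℝ)
    (h : ∀ i < r, ∀ s, s ≠ 0 → l i s = c₀ * l₀ i s + c₁ * l₁ i s + c₂ * l₂ i s)
    (F : (Fin p → ℤ) → ℝ) :
    chainOp v f g d n r l F = c₀ * chainOp v f g d n r l₀ F + c₁ * chainOp v f g d n r l₁ F +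
      c₂ * chainOp v f g d n r l₂ F := by
  induction r with
  | zero => simp [chainOp]
  | succ r ih =>
    rw [chainOp, chainOp, chainOp, chainOp, ih fun i hi => h i (hi.trans (Nat.lt_succ_self r)),
      h r (Nat.lt_succ_self r) 1 (by decide), h r (Nat.lt_succ_self r) (-1) (by decide)]
    ring

theorem chainOp_sub (r : ℕ) (l : ℕ → SignType → ℝ) (F G : (Fin p → ℤ) → ℝ) :
    chainOp v f g d n r l (F - G) = chainOp v f g d n r l F - chainOp v f g d n r l G := by
  simp only [← sum_ne_zero_eq_chainOp, map_sub, Pi.sub_apply, mul_sub, Finset.sum_sub_distrib]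

end chainOp

theorem chainWeight_congr {f f' : ℕ → SignType → ℝ} {g g' : ℕ → SignType → ℕ → SignType → ℝ}
    {d d' : ℕ → SignType → ℝ} {l l' : ℕ → SignType → ℝ} {r : ℕ} (ν : Fin r → SignType)
    (hf : ∀ i < r, ∀ s, f i s = f' i s)
    (hg : ∀ i < r, ∀ s, ∀ k < r, ∀ t, g i s k t = g' i s k t)
    (hd : ∀ i < r, ∀ s, d i s = d' i s) (hl : ∀ i < r, ∀ s, l i s = l' i s) :
    chainWeight f g d l ν = chainWeight f' g' d' l' ν := by
  simp only [chainWeight, hf _ (Fin.is_lt _), hg _ (Fin.is_lt _) _ _ (Fin.is_lt _),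
    hd _ (Fin.is_lt _), hl _ (Fin.is_lt _)]

theorem racahA_eq_chainWeight (j : ℕ) (β x : ℕ → ℝ) (ν : Fin j → SignType) :
    let X : ℕ → SignType → ℝ := fun i s => if s = -1 then -x (i + 1) - β (i + 1) else x (i + 1)
    racahA j β x ν = chainWeight
      (fun i s => (X i s + β (i + 1) - β 0) * (X i s + β (i + 1)))
      (fun i s k t => (X k t + X i s + β (k + 1)) * (X k t + X i s + β (k + 1) + 1))
      (fun i s => (2 * X i s + β (i + 1)) * (2 * X i s + β (i + 1) + 1))
      (fun i s => (X i s + β (j + 1) + x (j + 1)) * (x (j + 1) - X i s)) ν := by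
  intro X
  simp only [racahA, chainWeight, Finset.prod_filter, Finset.prod_product, Finset.mem_filter,
    Finset.mem_univ, true_and]
  congr 1
  · congr 1
    congr 1
    · refine Finset.prod_congr rfl fun i _ => ?_
      by_cases h : ν i ≠ 0 <;> simp [h, X]
    · refine Finset.prod_congr rfl fun i _ => ?_
      by_cases h : ν i ≠ 0
      · rw [if_pos h]
        refine Finset.prod_congr rfl fun k _ => ?_
        by_cases h' : ν k ≠ 0 <;> simp [h, h', X]
      · simp [h]
  · refine Finset.prod_congr rfl fun i _ => ?_
    by_cases h : ν i ≠ 0 <;> simp [h, X]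

/-! ### The limit of the dual Racah operator -/

/-- The involution of the Racah variables in the coordinates used for the Hahn operators. -/
def levelVal (T g : ℕ → ℝ) (i : ℕ) (s : SignType) : ℝ := if s = -1 then -T i - g i else T i

/-- The weights of pairs of consecutive indices, as a function of the value `z` at the second. -/
def levelPair (T g : ℕ → ℝ) (z : ℝ) (i : ℕ) (s : SignType) : ℝ :=
  (z + levelVal T g i s + g i) * (z + levelVal T g i s + g i + 1)

/-- The denominators. -/
def levelDen (T g : ℕ → ℝ) (i : ℕ) (s : SignType) : ℝ :=
  (2 * levelVal T g i s + g i) * (2 * levelVal T g i s + g i + 1)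

/-- The weights of the last index. -/
def levelEnd (T g : ℕ → ℝ) (r : ℕ) (i : ℕ) (s : SignType) : ℝ :=
  (levelVal T g i s + g i + T r) * (T r + g r - levelVal T g i s - g i)

/-- The limit operators `𝔏̃^n` for general sequences of data. -/
def levelOp {p : ℕ} (v : ℕ → Fin p → ℤ) (T g : ℕ → ℝ) (N : ℝ) (n : Fin p → ℤ) :
    (r : ℕ) → (l : ℕ → SignType → ℝ) → ((Fin p → ℤ) → ℝ) → ℝ :=
  chainOp v (fun i s => N - levelVal T g i s) (fun i s k t => levelPair T g (levelVal T g k t) i s)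
    (levelDen T g) n

/-- The partial sums `N_1^{p-i}`. -/
def levelSum {p : ℕ} (n : Fin p → ℤ) (i : ℕ) : ℝ := psum (fun k => (n k : ℝ)) (p - i)

/-- The parameters `γ_1^{p-i+1} + p - i`. -/
def levelParam {p : ℕ} (γ : Fin (p + 1) → ℝ) (i : ℕ) : ℝ := psum γ (p - i + 1) + (p - i : ℕ)

theorem psum_zero {m : ℕ} (v : Fin m → ℝ) : psum v 0 = 0 := by simp [psum]

/-- The substituted variables are `T + g + N` and the parameters `-g - 2N`, so `X + B` equals
`levelVal - N`. The first weight becomes `(N - levelVal)^2 + β₀ (N - levelVal)`, and no other weight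
contains `β₀`. -/
theorem racahDualOp_eq {p j : ℕ} (hjp : j ≤ p) (γ : Fin (p + 1) → ℝ) (N : ℝ)
    (F : (Fin p → ℤ) → ℝ) (n : Fin p → ℤ) (β₀ : ℝ) :
    racahDualOp j (hahnParam γ β₀) N F n =
      chainOp (fun i => dualShift p (i + 1))
        (fun i s => (N - levelVal (levelSum n) (levelParam γ) i s) ^ 2)
        (fun i s k t => levelPair (levelSum n) (levelParam γ)
          (levelVal (levelSum n) (levelParam γ) k t) i s)
        (levelDen (levelSum n) (levelParam γ)) n j
        (levelEnd (levelSum n) (levelParam γ) j) F +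
      β₀ * levelOp (fun i => dualShift p (i + 1)) (levelSum n) (levelParam γ) N n j
        (levelEnd (levelSum n) (levelParam γ) j) F := by
  set T := levelSum n with hT
  set g := levelParam γ with hg
  have h0 : hahnParam γ β₀ 0 = β₀ := by simp [hahnParam, psum_zero]
  have hvar : ∀ i < p, dualVar (hahnParam γ β₀) N n (i + 1) = T i + g i + N := by
    intro i hi
    rw [dualVar, if_pos (by omega), h0, hT, hg, levelSum, levelParam, hahnParam,
      show p + 1 - (i + 1) = p - i by omega, show p + 2 - (i + 1) = p - i + 1 by omega]
    push_cast
    ring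
  have hpar : ∀ i ≤ p, dualParam p (hahnParam γ β₀) N (i + 1) = -g i - 2 * N := by
    intro i hi
    rw [dualParam, if_neg (by omega), h0, hg, levelParam, hahnParam,
      show p + 2 - (i + 1) = p - i + 1 by omega]
    push_cast
    ring
  have hpar0 : dualParam p (hahnParam γ β₀) N 0 = β₀ := by rw [dualParam, if_pos rfl, h0]
  have hend : ∀ z : ℝ, (z + g j + N + dualParam p (hahnParam γ β₀) N (j + 1) +
      dualVar (hahnParam γ β₀) N n (j + 1)) * (dualVar (hahnParam γ β₀) N n (j + 1) - (z + g j + N))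
      = (z + g j + T j) * (T j - z) := by
    intro z
    rw [hpar j hjp]
    -- For `j = p` the outer variable is `N` instead of `T + g + N`. As `T p = 0`, these two values
    -- are exchanged by the involution, under which the end weight is invariant.
    rcases hjp.lt_or_eq with h | h
    · rw [hvar j h]; ring
    · have : T j = 0 := by rw [hT, levelSum, h, Nat.sub_self, psum_zero]
      rw [dualVar, if_neg (by omega), this]; ring
  rw [levelOp, ← chainOp_add_mul_first, ← sum_ne_zero_eq_chainOp, racahDualOp]
  refine Finset.sum_congr rfl fun ν _ => ?_
  congr 2
  rw [racahA_eq_chainWeight]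
  have hX : ∀ i < j, ∀ s : SignType, (if s = -1 then -dualVar (hahnParam γ β₀) N n (i + 1) -
      dualParam p (hahnParam γ β₀) N (i + 1) else dualVar (hahnParam γ β₀) N n (i + 1)) =
      levelVal T g i s + g i + N := by
    intro i hi s
    rw [hvar i (by omega), hpar i (by omega), levelVal]
    split_ifs <;> ring
  refine chainWeight_congr ν (fun i hi s => ?_) (fun i hi s k hk t => ?_) (fun i hi s => ?_)
    (fun i hi s => ?_) <;> beta_reduce
  · rw [hX i hi, hpar i (by omega), hpar0]; ring
  · rw [hX i hi, hX k hk, hpar k (by omega), levelPair]; ring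
  · rw [hX i hi, hpar i (by omega), levelDen]; ring
  · have h := hend (levelVal T g i s + g i - g j)
    rw [hX i hi, levelEnd]
    rw [show levelVal T g i s + g i - g j + g j + N = levelVal T g i s + g i + N by ring] at h
    rw [h]; ring

theorem tendsto_racahDualOp {p j : ℕ} (hjp : j ≤ p) (γ : Fin (p + 1) → ℝ) (N : ℝ)
    (F : (Fin p → ℤ) → ℝ) (n : Fin p → ℤ) :
    Tendsto (fun β₀ : ℝ => racahDualOp j (hahnParam γ β₀) N F n / β₀) atTop
      (𝓝 (levelOp (fun i => dualShift p (i + 1)) (levelSum n) (levelParam γ) N n j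
        (levelEnd (levelSum n) (levelParam γ) j) F)) := by
  simp only [racahDualOp_eq hjp]
  set A := chainOp (fun i => dualShift p (i + 1))
        (fun i s => (N - levelVal (levelSum n) (levelParam γ) i s) ^ 2)
        (fun i s k t => levelPair (levelSum n) (levelParam γ)
          (levelVal (levelSum n) (levelParam γ) k t) i s)
        (levelDen (levelSum n) (levelParam γ)) n j
        (levelEnd (levelSum n) (levelParam γ) j) F
  set B := levelOp (fun i => dualShift p (i + 1)) (levelSum n) (levelParam γ) N n j
        (levelEnd (levelSum n) (levelParam γ) j) F
  have h : Tendsto (fun β₀ : ℝ => A * β₀⁻¹ + B) atTop (𝓝 (A * 0 + B)) :=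
    (tendsto_inv_atTop_zero.const_mul A).add_const B
  rw [mul_zero, zero_add] at h
  refine h.congr' ?_
  filter_upwards [eventually_ne_atTop 0] with β₀ hβ
  field_simp

theorem hahnOpN_eq {p j : ℕ} (hjp : j ≤ p) (γ : Fin (p + 1) → ℝ) (N : ℝ)
    (F : (Fin p → ℤ) → ℝ) (n : Fin p → ℤ) :
    hahnOpN j γ N F n = levelOp (fun i => dualShift p (i + 1)) (levelSum n) (levelParam γ) N n j
        (levelEnd (levelSum n) (levelParam γ) j) F :=
  (tendsto_racahDualOp hjp γ N F n).limUnder_eq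

/-! ### Three-term relations -/

/-- Composition of `hahn1_raise_a` with `hahn1_raise_a_shift` at `a + 1`. The degrees 0 and 1 are
separate because `n - 1` and `n - 2` are truncated; the coefficients of the spurious terms vanish
there. -/
theorem hahn1_three_term_raise (n : ℕ) (x a b M : ℝ) :
    (2 * n + a + b) * (2 * n + a + b + 1) * (2 * n + a + b + 2) * hahn1 n x a b M =
      (n + a + b + 1) * (n + a + b + 2) * (2 * n + a + b) * hahn1 n (x - 1) (a + 2) b (M - 1) +
      n * (n + a + b + 1) * (n + b) * (2 * n + a + b + 1) * (2 * M + a + b + 2) *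
        hahn1 (n - 1) (x - 1) (a + 2) b (M - 1) +
      n * (n - 1) * (n + b) * (n + b - 1) * (2 * n + a + b + 2) *
        ((M - n + 1) * (M + n + a + b + 1)) * hahn1 (n - 2) (x - 1) (a + 2) b (M - 1) := by
  match n with
  | 0 => simp [hahn1_zero]; ring
  | 1 =>
    have h1 := hahn1_raise_a 0 x a b M
    have h2 := hahn1_raise_a_shift 0 x (a + 1) b M
    rw [show a + 1 + 1 = a + 2 by ring] at h2
    simp only [zero_add, hahn1_zero, Nat.cast_zero, Nat.cast_one, Nat.sub_self] at *
    linear_combination (a + b + 2) * (a + b + 4) * h1 + (a + b + 2) ^ 2 * h2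
  | n + 2 =>
    have h1 := hahn1_raise_a (n + 1) x a b M
    have h2 := hahn1_raise_a_shift (n + 1) x (a + 1) b M
    have h3 := hahn1_raise_a_shift n x (a + 1) b M
    rw [show a + 1 + 1 = a + 2 by ring] at h2 h3
    rw [show n + 1 + 1 = n + 2 by ring] at h1 h2
    rw [show n + 2 - 1 = n + 1 by omega, Nat.add_sub_cancel]
    push_cast at *
    linear_combination (2 * (n + 2) + a + b) * (2 * (n + 2) + a + b + 2) * h1 +
      (2 * (n + 2) + a + b) * (n + a + b + 3) * h2 +
      (2 * (n + 2) + a + b + 2) * (n + 2) * (n + 2 + b) * (M - n - 1) * h3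

/-- The recurrence in the degree, obtained by lowering `a` with `hahn1_lower_a` and raising it back
with `hahn1_raise_a`. -/
theorem hahn1_three_term (n : ℕ) (x a b M : ℝ) :
    (2 * n + a + b) * (2 * n + a + b + 1) * (2 * n + a + b + 2) * (x + a) * hahn1 n x a b M =
      (n + a + b + 1) * (2 * n + a + b) * hahn1 (n + 1) x a b M +
      n * (n + a) * (n + b) * (2 * n + a + b + 2) *
        ((M - n + 1) * (M + n + a + b + 1)) * hahn1 (n - 1) x a b M +
      ((2 * n + a + b) * (n + 1) * (n + 1 + b) * (M - n) +
        (2 * n + a + b + 2) * (a + n) * (n + a + b) * (M + n + a + b + 1)) * hahn1 n x a b M := by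
  have h1 := hahn1_lower_a n x a b M
  have h2 := hahn1_raise_a n x (a - 1) b M
  rw [sub_add_cancel] at h2
  rcases n with _ | n
  · simp only [zero_add, hahn1_zero, Nat.cast_zero] at *
    linear_combination (a + b) * (a + b + 2) * h1 + (a + b) * h2
  · have h3 := hahn1_raise_a n x (a - 1) b M
    rw [sub_add_cancel] at h3
    rw [Nat.add_sub_cancel]
    push_cast at *
    linear_combination (2 * (n + 1) + a + b) * (2 * (n + 1) + a + b + 2) * h1 +
      (2 * (n + 1) + a + b) * h2 +
      (2 * (n + 1) + a + b + 2) * (a + n + 1) * (M + n + 1 + a + b + 1) * h3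

theorem hahn1_three_term_lower (n : ℕ) (x a b M : ℝ) :
    (2 * n + a + b) * (2 * n + a + b + 1) * (2 * n + a + b + 2) * ((x + 1) * (x + a)) *
        hahn1 n x a b M =
      (2 * n + a + b) * hahn1 (n + 2) (x + 1) (a - 2) b (M + 1) +
      (a + n) * (2 * n + a + b + 1) * (2 * M + a + b + 2) *
        hahn1 (n + 1) (x + 1) (a - 2) b (M + 1) +
      (a + n) * (a + n - 1) * (2 * n + a + b + 2) * ((M - n + 1) * (M + n + a + b + 1)) *
        hahn1 n (x + 1) (a - 2) b (M + 1) := by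
  have h1 := hahn1_lower_a n x a b M
  have h2 := hahn1_lower_a_shift (n + 1) x (a - 1) b M
  have h3 := hahn1_lower_a_shift n x (a - 1) b M
  rw [show a - 1 - 1 = a - 2 by ring] at h2 h3
  rw [show n + 1 + 1 = n + 2 by ring] at h2
  push_cast at *
  linear_combination (2 * n + a + b) * (2 * n + a + b + 2) * (x + 1) * h1 +
    (2 * n + a + b) * h2 +
    (2 * n + a + b + 2) * (a + n) * (M + n + a + b + 1) * h3

/-- The Hahn polynomial divided by `(b+1)_n`. -/
def hahnN (n : ℕ) (x a b M : ℝ) : ℝ := hahn1 n x a b M / poch (b + 1) n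

section hahnN

variable (n : ℕ) (x a b M : ℝ) (h0 : 2 * n + a + b + 1 ≠ 0) (h1 : 2 * n + a + b + 1 ≠ 1)
  (h2 : 2 * n + a + b + 1 ≠ -1)

include h0 h1 h2

theorem hahnN_three_term_raise (hb : poch (b + 1) n ≠ 0) :
    (n + a + b + 1) * (n + a + b + 2) / ((2 * n + a + b + 1) * (2 * n + a + b + 2)) *
        hahnN n (x - 1) (a + 2) b (M - 1) +
      n * (n + a + b + 1) * (2 * M + a + b + 2) / ((2 * n + a + b) * (2 * n + a + b + 2)) *
        hahnN (n - 1) (x - 1) (a + 2) b (M - 1) +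
      n * (n - 1) / ((2 * n + a + b) * (2 * n + a + b + 1)) *
        ((M - n + 1) * (M + n + a + b + 1)) * hahnN (n - 2) (x - 1) (a + 2) b (M - 1) =
      hahnN n x a b M := by
  have h := hahn1_three_term_raise n x a b M
  have h1' : 2 * n + a + b ≠ 0 := fun h => h1 (by linarith)
  have h2' : 2 * n + a + b + 2 ≠ 0 := fun h => h2 (by linarith)
  -- The factor `n` is kept so that the identity survives at `n = 0`, where the index `n - 1` is
  -- truncated.
  have e1 : n * hahnN (n - 1) (x - 1) (a + 2) b (M - 1) =
      n * (n + b) * hahn1 (n - 1) (x - 1) (a + 2) b (M - 1) / poch (b + 1) n := by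
    rcases n with _ | n
    · simp
    · rw [Nat.add_sub_cancel, hahnN]
      rw [poch_succ] at hb ⊢
      have := left_ne_zero_of_mul hb
      have := right_ne_zero_of_mul hb
      push_cast
      rw [show b + 1 + (n : ℝ) = n + 1 + b by ring] at *
      field_simp
  have e2 : n * (n - 1) * hahnN (n - 2) (x - 1) (a + 2) b (M - 1) =
      n * (n - 1) * (n + b) * (n + b - 1) * hahn1 (n - 2) (x - 1) (a + 2) b (M - 1) /
        poch (b + 1) n := by
    rcases n with _ | _ | n
    · simp
    · simp
    · rw [show n + 1 + 1 - 2 = n by omega, hahnN]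
      rw [poch_succ, poch_succ] at hb ⊢
      have := left_ne_zero_of_mul (left_ne_zero_of_mul hb)
      have := right_ne_zero_of_mul (left_ne_zero_of_mul hb)
      have := right_ne_zero_of_mul hb
      push_cast at *
      rw [show b + 1 + (n : ℝ) = n + 1 + b by ring,
        show b + 1 + ((n : ℝ) + 1) = n + 1 + 1 + b by ring] at *
      rw [show (n : ℝ) + 1 + 1 + b - 1 = n + 1 + b by ring]
      field_simp
  calc _ = (n + a + b + 1) * (n + a + b + 2) / ((2 * n + a + b + 1) * (2 * n + a + b + 2)) *
        hahnN n (x - 1) (a + 2) b (M - 1) +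
      (n + a + b + 1) * (2 * M + a + b + 2) / ((2 * n + a + b) * (2 * n + a + b + 2)) *
        (n * hahnN (n - 1) (x - 1) (a + 2) b (M - 1)) +
      1 / ((2 * n + a + b) * (2 * n + a + b + 1)) *
        ((M - n + 1) * (M + n + a + b + 1)) *
          (n * (n - 1) * hahnN (n - 2) (x - 1) (a + 2) b (M - 1)) := by ring
    _ = _ := by
      rw [e1, e2, hahnN, hahnN]
      clear h1 h2 e1 e2
      generalize 2 * (n : ℝ) + a + b = z at *
      field_simp
      linear_combination -h

theorem hahnN_three_term (hb : poch (b + 1) (n + 1) ≠ 0) :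
    -((n + a + b + 1) * (n + b + 1) / ((2 * n + a + b + 1) * (2 * n + a + b + 2))) *
        (hahnN (n + 1) x a b M - (M - n) * hahnN n x a b M) -
      n * (n + a) / ((2 * n + a + b) * (2 * n + a + b + 1)) *
        ((M - n + 1) * (M + n + a + b + 1) * hahnN (n - 1) x a b M -
          (M + n + a + b + 1) * hahnN n x a b M) =
      (M - x) * hahnN n x a b M := by
  have h := hahn1_three_term n x a b M
  have h1' : 2 * n + a + b ≠ 0 := fun h => h1 (by linarith)
  have h2' : 2 * n + a + b + 2 ≠ 0 := fun h => h2 (by linarith)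
  rw [poch_succ] at hb
  have hb1 := left_ne_zero_of_mul hb
  have hb2 : n + b + 1 ≠ 0 := fun h => right_ne_zero_of_mul hb (by linarith)
  have e1 : n * hahnN (n - 1) x a b M =
      n * (n + b) * hahn1 (n - 1) x a b M / poch (b + 1) n := by
    rcases n with _ | n
    · simp
    · rw [Nat.add_sub_cancel, hahnN]
      rw [poch_succ] at hb1 ⊢
      have := left_ne_zero_of_mul hb1
      have := right_ne_zero_of_mul hb1
      push_cast
      rw [show b + 1 + (n : ℝ) = n + 1 + b by ring] at *
      field_simp
  calc _ = -((n + a + b + 1) * (n + b + 1) / ((2 * n + a + b + 1) * (2 * n + a + b + 2))) *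
        (hahnN (n + 1) x a b M - (M - n) * hahnN n x a b M) -
      (n + a) / ((2 * n + a + b) * (2 * n + a + b + 1)) *
        ((M - n + 1) * (M + n + a + b + 1) * (n * hahnN (n - 1) x a b M) -
          n * (M + n + a + b + 1) * hahnN n x a b M) := by ring
    _ = _ := by
      rw [e1, hahnN, hahnN, poch_succ, show b + 1 + (n : ℝ) = n + b + 1 by ring]
      clear h1 h2 e1
      generalize hz : 2 * (n : ℝ) + a + b = z at *
      field_simp
      subst hz
      linear_combination h

theorem hahnN_three_term_lower (hb : poch (b + 1) (n + 2) ≠ 0) :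
    (n + b + 1) * (n + b + 2) / ((2 * n + a + b + 1) * (2 * n + a + b + 2)) *
        hahnN (n + 2) (x + 1) (a - 2) b (M + 1) +
      (a + n) * (n + b + 1) * (2 * M + a + b + 2) / ((2 * n + a + b) * (2 * n + a + b + 2)) *
        hahnN (n + 1) (x + 1) (a - 2) b (M + 1) +
      (a + n) * (a + n - 1) / ((2 * n + a + b) * (2 * n + a + b + 1)) *
        ((M - n + 1) * (M + n + a + b + 1)) * hahnN n (x + 1) (a - 2) b (M + 1) =
      (x + 1) * (x + a) * hahnN n x a b M := by
  have h := hahn1_three_term_lower n x a b M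
  have h1' : 2 * n + a + b ≠ 0 := fun h => h1 (by linarith)
  have h2' : 2 * n + a + b + 2 ≠ 0 := fun h => h2 (by linarith)
  rw [poch_succ, poch_succ] at hb
  have hb1 := left_ne_zero_of_mul (left_ne_zero_of_mul hb)
  have hb2 : n + b + 1 ≠ 0 := fun h =>
    right_ne_zero_of_mul (left_ne_zero_of_mul hb) (by linarith)
  have hb3 : n + b + 2 ≠ 0 := fun h => right_ne_zero_of_mul hb (by push_cast; linarith)
  rw [hahnN, hahnN, hahnN, hahnN, poch_succ _ (n + 1), poch_succ,
    show b + 1 + (n : ℝ) = n + b + 1 by ring,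
    show b + 1 + ((n + 1 : ℕ) : ℝ) = n + b + 2 by push_cast; ring]
  clear h1 h2
  generalize 2 * (n : ℝ) + a + b = z at *
  field_simp
  linear_combination -h

end hahnN

/-! ### The spectral equation in `n` for sequences of data -/

section levels

variable {p : ℕ} (v : ℕ → Fin p → ℤ) (T g : ℕ → ℝ) (N : ℝ) (n : Fin p → ℤ)

/-- The part of the operator to the left of an index at which the variable takes the value `z`. -/
def levelTail (r : ℕ) (z : ℝ) (F : (Fin p → ℤ) → ℝ) : ℝ :=
  (N - z) * F n + levelOp v T g N n r (levelPair T g z) F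

theorem levelOp_succ (r : ℕ) (l : ℕ → SignType → ℝ) (F : (Fin p → ℤ) → ℝ) :
    levelOp v T g N n (r + 1) l F = levelOp v T g N n r l F +
      (l r 1 / levelDen T g r 1 * (levelTail v T g N n r (T r) (fun m => F (m + v r)) -
        levelTail v T g N n r (T r) F) +
      l r (-1) / levelDen T g r (-1) * (levelTail v T g N n r (-T r - g r) (fun m => F (m - v r)) -
        levelTail v T g N n r (-T r - g r) F)) := by
  have e1 : stepDiff (v r) 1 F = (fun m => F (m + v r)) - F := by
    ext m; rw [stepDiff_one]; rfl
  have e2 : stepDiff (v r) (-1) F = (fun m => F (m - v r)) - F := by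
    ext m; rw [stepDiff_neg_one]; rfl
  have hv1 : levelVal T g r 1 = T r := by rw [levelVal, if_neg (by decide)]
  have hv2 : levelVal T g r (-1) = -T r - g r := by rw [levelVal, if_pos rfl]
  rw [levelOp, chainOp, e1, e2, chainOp_sub, chainOp_sub, hv1, hv2]
  simp only [levelTail, levelOp, Pi.sub_apply]
  change _ + (_ * (_ + (chainOp v _ _ _ n r (levelPair T g (T r)) _ -
    chainOp v _ _ _ n r (levelPair T g (T r)) _)) + _ * (_ +
      (chainOp v _ _ _ n r (levelPair T g (-T r - g r)) _ -
        chainOp v _ _ _ n r (levelPair T g (-T r - g r)) _))) = _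
  ring

variable {T g} {r : ℕ} (h0 : 2 * T r + g r ≠ 0) (h1 : 2 * T r + g r ≠ 1)
  (h2 : 2 * T r + g r ≠ -1)

include h0 h1 h2

/-- With `t = levelVal + g i`, the pair weight `(z + t)(z + t + 1)` is expanded in the pair weights
at `T r` and `-T r - g r` and the end weight at `r`. Evaluation at `t = T r + g r` and `t = -T r`
shows that the coefficients of the pair weights are the quotients `levelPair / levelDen` for the
index `r`. Hence the unshifted tails produced by the differences `E - 1` and `E⁻¹ - 1` cancel
against the expansion. -/
theorem levelTail_succ (z : ℝ) (F : (Fin p → ℤ) → ℝ) :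
    levelTail v T g N n (r + 1) z F =
      (z + T r + g r) * (z + T r + g r + 1) / ((2 * T r + g r) * (2 * T r + g r + 1)) *
        levelTail v T g N n r (T r) (fun m => F (m + v r)) +
      2 * (z - T r) * (z + T r + g r) / ((2 * T r + g r - 1) * (2 * T r + g r + 1)) *
        (levelOp v T g N n r (levelEnd T g r) F - (N + (1 + g r) / 2) * F n) +
      (z - T r) * (z - T r + 1) / ((2 * T r + g r) * (2 * T r + g r - 1)) *
        levelTail v T g N n r (-T r - g r) (fun m => F (m - v r)) := by
  have h1' : 2 * T r + g r - 1 ≠ 0 := fun h => h1 (by linarith)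
  have h2' : 2 * T r + g r + 1 ≠ 0 := fun h => h2 (by linarith)
  have hv1 : levelVal T g r 1 = T r := by rw [levelVal, if_neg (by decide)]
  have hv2 : levelVal T g r (-1) = -T r - g r := by rw [levelVal, if_pos rfl]
  have q1 : levelPair T g z r 1 / levelDen T g r 1 =
      (z + T r + g r) * (z + T r + g r + 1) / ((2 * T r + g r) * (2 * T r + g r + 1)) := by
    rw [levelPair, levelDen, hv1]
  have q2 : levelPair T g z r (-1) / levelDen T g r (-1) =
      (z - T r) * (z - T r + 1) / ((2 * T r + g r) * (2 * T r + g r - 1)) := by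
    rw [levelPair, levelDen, hv2]
    congr 1 <;> ring
  have hl := chainOp_linear_last v (fun i s => N - levelVal T g i s)
    (fun i s k t => levelPair T g (levelVal T g k t) i s) (levelDen T g) n r
    (levelPair T g z) (levelPair T g (T r)) (levelEnd T g r) (levelPair T g (-T r - g r))
    ((z + T r + g r) * (z + T r + g r + 1) / ((2 * T r + g r) * (2 * T r + g r + 1)))
    (2 * (z - T r) * (z + T r + g r) / ((2 * T r + g r - 1) * (2 * T r + g r + 1)))
    ((z - T r) * (z - T r + 1) / ((2 * T r + g r) * (2 * T r + g r - 1)))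
    (by
      intro i _ s _
      simp only [levelPair, levelEnd]
      simp only [add_assoc _ (levelVal T g i s) (g i), sub_sub (T r + g r)]
      generalize levelVal T g i s + g i = t
      generalize hZ : 2 * T r + g r = Z at *
      have hg : g r = Z - 2 * T r := by linarith
      rw [hg]
      field_simp
      ring) F
  -- The scalar counterpart of the expansion, for the terms in which no earlier index is selected;
  -- it accounts for the constant `N + (1 + g r) / 2`.
  have hs : (N - z) - (z + T r + g r) * (z + T r + g r + 1) /
        ((2 * T r + g r) * (2 * T r + g r + 1)) * (N - T r) -
      (z - T r) * (z - T r + 1) / ((2 * T r + g r) * (2 * T r + g r - 1)) * (N - (-T r - g r)) =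
      -(2 * (z - T r) * (z + T r + g r) / ((2 * T r + g r - 1) * (2 * T r + g r + 1))) *
        (N + (1 + g r) / 2) := by
    clear hl q1 q2 hv1 hv2
    generalize hZ : 2 * T r + g r = Z at *
    have hg : g r = Z - 2 * T r := by linarith
    rw [hg]
    field_simp
    ring
  rw [levelTail, levelOp_succ, q1, q2]
  simp only [levelTail, levelOp] at *
  rw [hl]
  linear_combination F n * hs

/-- The end weight at `r + 1` is expanded in the same basis. The pair coefficients again match the
weights of the new index, and the coefficient of the old end weight is one plus their sum. -/
theorem levelOp_succ_end (F : (Fin p → ℤ) → ℝ) :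
    levelOp v T g N n (r + 1) (levelEnd T g (r + 1)) F =
      levelOp v T g N n r (levelEnd T g r) F +
      (T r + g r + T (r + 1)) * (T (r + 1) + g (r + 1) - T r - g r) /
        ((2 * T r + g r) * (2 * T r + g r + 1)) *
        (levelOp v T g N n r (levelEnd T g r) F - (N - T r) * F n +
          levelTail v T g N n r (T r) (fun m => F (m + v r))) +
      (T (r + 1) - T r) * (T (r + 1) + g (r + 1) + T r) /
        ((2 * T r + g r) * (2 * T r + g r - 1)) *
        (levelOp v T g N n r (levelEnd T g r) F - (N + T r + g r) * F n +
          levelTail v T g N n r (-T r - g r) (fun m => F (m - v r))) := by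
  have h1' : 2 * T r + g r - 1 ≠ 0 := fun h => h1 (by linarith)
  have h2' : 2 * T r + g r + 1 ≠ 0 := fun h => h2 (by linarith)
  have hv1 : levelVal T g r 1 = T r := by rw [levelVal, if_neg (by decide)]
  have hv2 : levelVal T g r (-1) = -T r - g r := by rw [levelVal, if_pos rfl]
  have q1 : levelEnd T g (r + 1) r 1 / levelDen T g r 1 =
      (T r + g r + T (r + 1)) * (T (r + 1) + g (r + 1) - T r - g r) /
        ((2 * T r + g r) * (2 * T r + g r + 1)) := by
    rw [levelEnd, levelDen, hv1]
  have q2 : levelEnd T g (r + 1) r (-1) / levelDen T g r (-1) =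
      (T (r + 1) - T r) * (T (r + 1) + g (r + 1) + T r) /
        ((2 * T r + g r) * (2 * T r + g r - 1)) := by
    rw [levelEnd, levelDen, hv2]
    congr 1 <;> ring
  have hl := chainOp_linear_last v (fun i s => N - levelVal T g i s)
    (fun i s k t => levelPair T g (levelVal T g k t) i s) (levelDen T g) n r
    (levelEnd T g (r + 1)) (levelPair T g (T r)) (levelEnd T g r) (levelPair T g (-T r - g r))
    ((T r + g r + T (r + 1)) * (T (r + 1) + g (r + 1) - T r - g r) /
        ((2 * T r + g r) * (2 * T r + g r + 1)))
    (1 + (T r + g r + T (r + 1)) * (T (r + 1) + g (r + 1) - T r - g r) /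
        ((2 * T r + g r) * (2 * T r + g r + 1)) +
      (T (r + 1) - T r) * (T (r + 1) + g (r + 1) + T r) /
        ((2 * T r + g r) * (2 * T r + g r - 1)))
    ((T (r + 1) - T r) * (T (r + 1) + g (r + 1) + T r) /
        ((2 * T r + g r) * (2 * T r + g r - 1)))
    (by
      intro i _ s _
      simp only [levelPair, levelEnd]
      simp only [add_assoc _ (levelVal T g i s) (g i), sub_sub _ (levelVal T g i s) (g i)]
      generalize levelVal T g i s + g i = t
      clear q1 q2 hv1 hv2
      generalize hZ : 2 * T r + g r = Z at *
      have hg : g r = Z - 2 * T r := by linarith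
      rw [hg]
      field_simp
      ring) F
  rw [levelOp_succ, q1, q2]
  simp only [levelTail, levelOp] at *
  rw [hl]
  ring

end levels

/-- The factor of the product form of the Hahn polynomial at the level `r`, when the partial sums
below and at this level are shifted by `e` and `δ`; it is `hahnN k` with `k` the shifted index. -/
def levelFactor (T g Y b : ℕ → ℝ) (r k : ℕ) (e : ℤ) : ℝ :=
  hahnN k (Y (r + 1) - T (r + 1) - e) (2 * (T (r + 1) + e) + g (r + 1)) (b r)
    (Y r - T (r + 1) - e)

/-- `F` has, near `n` and along the first `r` translations, the product form of a Hahn polynomial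
with the next partial sum shifted by `e`, wherever the indices are nonnegative. -/
def IsProductForm {p : ℕ} (v : ℕ → Fin p → ℤ) (T g Y b : ℕ → ℝ) (nn : ℕ → ℕ) (top : ℤ → ℝ)
    (n : Fin p → ℤ) : ℕ → ℤ → ℝ → ((Fin p → ℤ) → ℝ) → Prop
  | 0, e, C, F => F n = C * top e
  | r + 1, e, C, F => ∀ (δ : ℤ) (k : ℕ), (k : ℤ) = nn r + δ - e →
      IsProductForm v T g Y b nn top n r δ (C * levelFactor T g Y b r k e) (fun m => F (m + δ • v r))

/-- The value of the product over the first `r` levels without shifts. -/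
def levelProd (T g Y b : ℕ → ℝ) (nn : ℕ → ℕ) (t : ℝ) : ℕ → ℝ
  | 0 => t
  | r + 1 => levelFactor T g Y b r (nn r) 0 * levelProd T g Y b nn t r

theorem poch_ne_zero_of_le {x : ℝ} {k m : ℕ} (h : poch x m ≠ 0) (hk : k ≤ m) : poch x k ≠ 0 := by
  obtain ⟨d, rfl⟩ := Nat.exists_eq_add_of_le hk
  induction d with
  | zero => simpa using h
  | succ d ih =>
    rw [← add_assoc, poch_succ] at h
    exact ih (left_ne_zero_of_mul h) (by omega)

/-- The three functionals must be treated together, since each recursion step calls all of them at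
the previous level with shifts `0, 1, -1`. At level zero only the prefactor `top` is left, and
`htop1`, `htop2` are its ratios. The bound `1 ≤ S r` excludes a negative shifted partial sum. -/
theorem levelOp_of_isProductForm {p : ℕ} (v : ℕ → Fin p → ℤ) (S nn : ℕ → ℕ) (g Y b : ℕ → ℝ)
    (N : ℝ) (n : Fin p → ℤ) (top : ℤ → ℝ) (r : ℕ)
    (hS : ∀ i < r, S i = S (i + 1) + nn i) (hg : ∀ i < r, g i = g (i + 1) + b i + 1)
    (hz : ∀ i < r, 2 * (S i : ℝ) + g i ≠ -1 ∧ 2 * (S i : ℝ) + g i ≠ 0 ∧ 2 * (S i : ℝ) + g i ≠ 1)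
    (hb : ∀ i < r, poch (b i + 1) (S 0 + 1) ≠ 0) (hY : Y 0 = N)
    (htop1 : (N - S 0) * top 1 = top 0)
    (htop2 : 1 ≤ S 0 → top (-1) = (N - S 0 + 1) * top 0) :
    (∀ C F, IsProductForm v (fun i => S i) g Y b nn top n r 0 C F →
      F n = C * levelProd (fun i => S i) g Y b nn (top 0) r ∧
      levelOp v (fun i => S i) g N n r (levelEnd (fun i => S i) g r) F =
        (N - Y r) * (C * levelProd (fun i => S i) g Y b nn (top 0) r)) ∧
    (∀ C F, IsProductForm v (fun i => S i) g Y b nn top n r 1 C F →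
      levelTail v (fun i => S i) g N n r (S r) F =
        C * levelProd (fun i => S i) g Y b nn (top 0) r) ∧
    (1 ≤ S r → ∀ C F, IsProductForm v (fun i => S i) g Y b nn top n r (-1) C F →
      levelTail v (fun i => S i) g N n r (-S r - g r) F =
        (Y r - S r + 1) * (Y r + S r + g r) *
          (C * levelProd (fun i => S i) g Y b nn (top 0) r)) := by
  induction r with
  | zero =>
    refine ⟨fun C F hF => ⟨hF, ?_⟩, fun C F hF => ?_, fun h C F hF => ?_⟩
    · simp [levelOp, chainOp, hY]
    · simp only [IsProductForm] at hF
      simp only [levelTail, levelOp, chainOp, hF, levelProd]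
      linear_combination C * htop1
    · simp only [IsProductForm] at hF
      simp only [levelTail, levelOp, chainOp, hF, levelProd, htop2 h, hY]
      ring
  | succ r ih =>
    obtain ⟨ih0, ih1, ih2⟩ := ih (fun i hi => hS i (by omega)) (fun i hi => hg i (by omega))
      (fun i hi => hz i (by omega)) (fun i hi => hb i (by omega))
    obtain ⟨hz2, hz0, hz1⟩ := hz r (by omega)
    have hSr := hS r (by omega)
    have hgr := hg r (by omega)
    have hbr := hb r (by omega)
    have hS0 : ∀ i ≤ r, S i ≤ S 0 := by
      intro i
      induction i with
      | zero => intro _; exact le_rfl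
      | succ i ih =>
        intro hi
        have := ih (by omega)
        have := hS i (by omega)
        omega
    have hSr0 := hS0 r le_rfl
    set T : ℕ → ℝ := fun i => (S i : ℝ) with hT
    have hTr : T r = T (r + 1) + nn r := by simp [hT, hSr]
    set G := levelProd T g Y b nn (top 0) r with hG
    set x := Y (r + 1) - T (r + 1) with hx
    set a := 2 * T (r + 1) + g (r + 1) with ha
    set M := Y r - T (r + 1) with hM
    have hzeq : 2 * T r + g r = 2 * nn r + a + b r + 1 := by rw [hTr, hgr, ha]; ring
    have hf0 : ∀ k, levelFactor T g Y b r k 0 = hahnN k x a (b r) M := by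
      intro k
      rw [levelFactor]
      congr 1 <;> simp [hx, ha, hM]
    have hf1 : ∀ k, levelFactor T g Y b r k 1 = hahnN k (x - 1) (a + 2) (b r) (M - 1) := by
      intro k
      rw [levelFactor]
      congr 1 <;> simp [hx, ha, hM]
      ring
    have hf2 : ∀ k, levelFactor T g Y b r k (-1) = hahnN k (x + 1) (a - 2) (b r) (M + 1) := by
      intro k
      rw [levelFactor]
      congr 1 <;> simp [hx, ha, hM]
      ring
    have hGs : levelProd T g Y b nn (top 0) (r + 1) = hahnN (nn r) x a (b r) M * G := by
      rw [levelProd, hf0]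
    -- the values of the three functionals at level `r` on product forms at level `r + 1`
    have c0 : ∀ {e : ℤ} {C F} (k : ℕ), (k : ℤ) = nn r - e →
        IsProductForm v T g Y b nn top n (r + 1) e C F →
        F n = C * levelFactor T g Y b r k e * G ∧
        levelOp v T g N n r (levelEnd T g r) F =
          (N - Y r) * (C * levelFactor T g Y b r k e * G) := by
      intro e C F k hk hF
      have h := ih0 _ _ (hF 0 k (by omega))
      simpa using h
    have c1 : ∀ {e : ℤ} {C F} (k : ℕ), (k : ℤ) = nn r + 1 - e →
        IsProductForm v T g Y b nn top n (r + 1) e C F →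
        levelTail v T g N n r (T r) (fun m => F (m + v r)) =
          C * levelFactor T g Y b r k e * G := by
      intro e C F k hk hF
      have h := ih1 _ _ (hF 1 k (by omega))
      simpa using h
    have c2 : ∀ {e : ℤ} {C F} (k : ℕ), (k : ℤ) = nn r - 1 - e → 1 ≤ S r →
        IsProductForm v T g Y b nn top n (r + 1) e C F →
        levelTail v T g N n r (-T r - g r) (fun m => F (m - v r)) =
          (M - nn r + 1) * (M + nn r + a + b r + 1) * (C * levelFactor T g Y b r k e * G) := by
      intro e C F k hk h1 hF
      have h := ih2 h1 _ _ (hF (-1) k (by omega))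
      rw [show M - nn r + 1 = Y r - T r + 1 by rw [hM, hTr]; ring,
        show M + nn r + a + b r + 1 = Y r + T r + g r by rw [hM, ha, hTr, hgr]; ring]
      simpa [sub_eq_add_neg] using h
    rw [hGs]
    have eYr : Y r = M + T (r + 1) := by rw [hM]; ring
    have eYs : Y (r + 1) = x + T (r + 1) := by rw [hx]; ring
    have egs : g (r + 1) = a - 2 * T (r + 1) := by rw [ha]; ring
    have egr : g r = a - 2 * T (r + 1) + b r + 1 := by rw [hgr, egs]
    have hz0' : 2 * (nn r : ℝ) + a + b r + 1 ≠ 0 := hzeq ▸ hz0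
    have hz1' : 2 * (nn r : ℝ) + a + b r + 1 ≠ 1 := hzeq ▸ hz1
    have hz2' : 2 * (nn r : ℝ) + a + b r + 1 ≠ -1 := hzeq ▸ hz2
    refine ⟨fun C F hF => ?_, fun C F hF => ?_, fun h C F hF => ?_⟩
    · obtain ⟨d0, d0'⟩ := c0 (nn r) (by omega) hF
      have d1 := c1 (nn r + 1) (by omega) hF
      rw [hf0] at d0 d0' d1
      refine ⟨by rw [d0]; ring, ?_⟩
      have key := hahnN_three_term (nn r) x a (b r) M hz0' hz1' hz2'
        (poch_ne_zero_of_le hbr (by omega))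
      -- The coefficient is `-nn r`; it vanishes exactly when the backward step would leave the
      -- nonnegative indices, so the values of `F` there do not matter.
      have d2 : (T (r + 1) - T r) *
          levelTail v T g N n r (-T r - g r) (fun m => F (m - v r)) =
          (T (r + 1) - T r) * ((M - nn r + 1) * (M + nn r + a + b r + 1) *
            (C * hahnN (nn r - 1) x a (b r) M * G)) := by
        rcases Nat.eq_zero_or_pos (nn r) with h | h
        · rw [hTr, h]; simp
        · rw [c2 (nn r - 1) (by omega) (by omega) hF, hf0]
      change levelOp v T g N n (r + 1) (levelEnd T g (r + 1)) F =
        (N - Y (r + 1)) * (C * (hahnN (nn r) x a (b r) M * G))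
      rw [levelOp_succ_end v N n hz0 hz1 hz2, d0', d0, d1]
      generalize levelTail v T g N n r (-T r - g r) (fun m => F (m - v r)) = t at d2 ⊢
      rw [eYr, eYs, egr, egs, hTr] at *
      linear_combination C * G * key + (a + nn r) /
        ((2 * nn r + a + b r) * (2 * nn r + a + b r + 1)) * d2
    · have d1 := c1 (nn r) (by omega) hF
      rw [hf1] at d1
      have key := hahnN_three_term_raise (nn r) x a (b r) M hz0' hz1' hz2'
        (poch_ne_zero_of_le hbr (by omega))
      -- With the next partial sum shifted by `1`, the index is `nn r - 1` here and `nn r - 2` in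
      -- `d2`. The factors `nn r` and `nn r * (nn r - 1)` remove the inadmissible cases.
      have d0 : nn r *
          (levelOp v T g N n r (levelEnd T g r) F - (N + (1 + g r) / 2) * F n) =
          nn r * (((N - Y r) - (N + (1 + g r) / 2)) *
            (C * hahnN (nn r - 1) (x - 1) (a + 2) (b r) (M - 1) * G)) := by
        rcases Nat.eq_zero_or_pos (nn r) with h | h
        · rw [h]; simp
        · obtain ⟨d, d'⟩ := c0 (nn r - 1) (by omega) hF
          rw [d, d', hf1]; ring
      have d2 : nn r * (nn r - 1) *
          levelTail v T g N n r (-T r - g r) (fun m => F (m - v r)) =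
          nn r * (nn r - 1) * ((M - nn r + 1) * (M + nn r + a + b r + 1) *
            (C * hahnN (nn r - 2) (x - 1) (a + 2) (b r) (M - 1) * G)) := by
        rcases Nat.lt_or_ge (nn r) 2 with h | h
        · interval_cases nn r <;> simp
        · rw [c2 (nn r - 2) (by omega) (by omega) hF, hf1]
      change levelTail v T g N n (r + 1) (T (r + 1)) F =
        C * (hahnN (nn r) x a (b r) M * G)
      rw [levelTail_succ v N n hz0 hz1 hz2, d1]
      generalize levelTail v T g N n r (-T r - g r) (fun m => F (m - v r)) = t at d2 ⊢
      generalize levelOp v T g N n r (levelEnd T g r) F - (N + (1 + g r) / 2) * F n = u at d0 ⊢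
      rw [eYr, egr, hTr] at *
      linear_combination C * G * key + 1 /
        ((2 * nn r + a + b r) * (2 * nn r + a + b r + 1)) * d2 -
        2 * (nn r + a + b r + 1) / ((2 * nn r + a + b r) * (2 * nn r + a + b r + 2)) * d0
    · have d1 := c1 (nn r + 2) (by omega) hF
      obtain ⟨d0, d0'⟩ := c0 (nn r + 1) (by omega) hF
      have d2 := c2 (nn r) (by omega) (by omega) hF
      rw [hf2] at d0 d0' d1 d2
      have key := hahnN_three_term_lower (nn r) x a (b r) M hz0' hz1' hz2'
        (poch_ne_zero_of_le hbr (by omega))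
      change levelTail v T g N n (r + 1) (-T (r + 1) - g (r + 1)) F =
        (Y (r + 1) - T (r + 1) + 1) * (Y (r + 1) + T (r + 1) + g (r + 1)) *
          (C * (hahnN (nn r) x a (b r) M * G))
      rw [levelTail_succ v N n hz0 hz1 hz2, d1, d0, d0', d2]
      rw [eYr, eYs, egr, egs, hTr] at *
      linear_combination C * G * key

/-! ### The product form of the Hahn polynomials -/

theorem seqSum_extend_self {R : Type*} [AddCommMonoid R] {m : ℕ} (v : Fin m → R) :
    seqSum (extend v) m = ∑ i, v i := by
  rw [seqSum, Finset.sum_range]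
  simp [extend_val]

/-- The factor number `k` of the product in `hahnH`, divided by its normalization, for indices
in `ℤ`. -/
def extFactor (n : ℕ → ℤ) (γ y : ℕ → ℝ) (k : ℕ) : ℝ :=
  hahnN (n k).toNat (seqSum y (k + 1) - (seqSum n k : ℤ))
    (2 * (seqSum n k : ℤ) + seqSum γ (k + 1) + k) (γ (k + 1)) (seqSum y (k + 2) - (seqSum n k : ℤ))

/-- The prefactor `(-1)^m / (-N)_m` with `m = t + e`. -/
def topFactor (N : ℝ) (t : ℕ) (e : ℤ) : ℝ := (-1) ^ (t + e).toNat / poch (-N) (t + e).toNat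

theorem hahnH_eq_extFactor {p : ℕ} (n : Fin p → ℤ) (hn : ∀ i, 0 ≤ n i) (y : Fin p → ℝ)
    (γ : Fin (p + 1) → ℝ) (N : ℝ) :
    hahnH (fun i => (n i).toNat) y γ N =
      (-1) ^ (∑ i, n i).toNat / poch (-N) (∑ i, n i).toNat *
        ∏ k ∈ Finset.range p, extFactor (extend n) (extend γ) (extend (compl y N)) k := by
  have h1 : (∑ i, n i).toNat = ∑ i, (n i).toNat := by
    zify
    rw [Int.toNat_of_nonneg (Finset.sum_nonneg fun i _ => hn i)]
    exact Finset.sum_congr rfl fun i _ => (Int.toNat_of_nonneg (hn i)).symm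
  have h2 : ∀ k, seqSum (extend n) k = (seqSum (extend fun i => (n i).toNat) k : ℕ) := by
    intro k
    rw [seqSum, seqSum]
    push_cast
    refine Finset.sum_congr rfl fun i _ => ?_
    unfold extend
    split
    · exact (Int.toNat_of_nonneg (hn _)).symm
    · simp
  rw [hahnH_eq_hahnProd, h1, hahnProd, Finset.prod_range, Finset.prod_range]
  have h3 : ∀ k : Fin p, extFactor (extend n) (extend γ) (extend (compl y N)) k =
      hahnFactor (extend fun i => (n i).toNat) (extend γ) (extend (compl y N)) k /
        poch (γ k.succ + 1) (n k).toNat := by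
    intro k
    rw [extFactor, hahnN, hahnFactor, h2, extend_val, extend_val, Int.cast_natCast,
      show extend γ ((k : ℕ) + 1) = γ k.succ from extend_val γ k.succ]
  rw [Finset.prod_congr rfl fun k _ => h3 k, Finset.prod_div_distrib]
  rw [div_mul_div_comm, div_mul_eq_mul_div]

section data

variable {p : ℕ} (n : Fin p → ℕ) (γ : Fin (p + 1) → ℝ) (N : ℝ) (y : Fin p → ℝ)

/-- A multiple `δ` of the translation at level `r` changes only the partial sum `N_1^{p-r}`, by `δ`.
Thus, going down from `r` to `0`, each step fixes one further index and hence one further factor.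
The induction runs over displaced points `n'` that agree with `n` beyond the position `p - r`, where
the shift `e` is compensated. -/
theorem isProductForm_hahnExt (c : (Fin p → ℤ) → ℝ) (r : ℕ) (hr : r ≤ p) (e : ℤ)
    (n' : Fin p → ℤ) (hnn : ∀ i : Fin p, (i : ℕ) < p - r → 0 ≤ n' i)
    (hsum : seqSum (extend n') (p - r) = seqSum (extend n) (p - r) + e)
    (heq : ∀ i : Fin p, (i : ℕ) = p - r → n' i = n i - e)
    (hgt : ∀ i : Fin p, p - r < (i : ℕ) → n' i = n i) :
    IsProductForm (fun i => dualShift p (i + 1)) (fun i => (seqSum (extend n) (p - i) : ℕ))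
      (levelParam γ) (fun i => seqSum (extend (compl y N)) (p - i + 1))
      (fun i => extend γ (p - i)) (fun i => extend n (p - i - 1))
      (topFactor N (∑ i, n i)) (fun i => (n i : ℤ)) r e
      (∏ k ∈ Finset.range (p - r), extFactor (extend n') (extend γ) (extend (compl y N)) k)
      (fun m => hahnExt c y γ N (m + (n' - fun i => (n i : ℤ)))) := by
  induction r generalizing e n' with
  | zero =>
    have h0 : ∀ i, 0 ≤ n' i := fun i => hnn i (by omega)
    rw [Nat.sub_zero, seqSum_extend_self, seqSum_extend_self] at hsum
    simp only [IsProductForm, add_sub_cancel, Nat.sub_zero]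
    rw [hahnExt, if_pos h0, hahnH_eq_extFactor n' h0, hsum, topFactor]
    exact mul_comm _ _
  | succ r ih =>
    intro δ k hk
    obtain ⟨m, hm⟩ : ∃ m, p - (r + 1) = m := ⟨_, rfl⟩
    have hpm : p - r = m + 1 := by omega
    have hmp : m < p := by omega
    rw [hm] at hnn hsum heq hgt
    simp only [hpm, Nat.add_sub_cancel] at hk
    -- The translation raises entry `m` and lowers entry `m + 1`; for `m + 1 = p` the second entry
    -- is absent, in accordance with `E_{n_{p+1}} = 1`.
    have hv : ∀ i : Fin p, (n' + δ • dualShift p (r + 1)) i =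
        if (i : ℕ) = m then (k : ℤ) else if (i : ℕ) = m + 1 then n' i - δ else n' i := by
      intro i
      simp only [Pi.add_apply, Pi.smul_apply, dualShift, smul_eq_mul,
        show p + 1 - (r + 1) = m + 1 by omega, show p + 2 - (r + 1) = m + 2 by omega]
      have hn : (i : ℕ) = m → extend n m = n i := by
        intro h; rw [← h, extend_val]
      split_ifs with h1 h2 h3 <;> try omega
      · rw [hn (by omega)] at hk
        rw [heq i (by omega), hk]; ring
    have hlow : ∀ i < m, extend (n' + δ • dualShift p (r + 1)) i = extend n' i := by
      intro i hi
      have h := hv ⟨i, by omega⟩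
      rw [if_neg (show ¬ i = m by omega), if_neg (show ¬ i = m + 1 by omega)] at h
      simpa [extend, show i < p by omega] using h
    have hmid : extend (n' + δ • dualShift p (r + 1)) m = k := by
      have h := hv ⟨m, hmp⟩
      rw [if_pos rfl] at h
      simpa [extend, hmp] using h
    have hlowsum : ∀ i ≤ m, seqSum (extend (n' + δ • dualShift p (r + 1))) i =
        seqSum (extend n') i := by
      intro i hi
      refine Finset.sum_congr rfl fun i' hi' => hlow _ ?_
      have := Finset.mem_range.mp hi'
      omega
    have key := ih (by omega) δ (n' + δ • dualShift p (r + 1))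
      (by
        intro i hi
        rw [hv]
        split_ifs with h1 h2
        · omega
        · omega
        · exact hnn i (by omega))
      (by
        rw [hpm, seqSum_succ, hlowsum m le_rfl, hmid, hsum, hk, seqSum_succ]
        push_cast
        ring)
      (by
        intro i hi
        rw [hv, if_neg (by omega), if_pos (by omega), hgt i (by omega)])
      (by
        intro i hi
        rw [hv, if_neg (by omega), if_neg (by omega), hgt i (by omega)])
    have hC : ∏ k ∈ Finset.range (p - r), extFactor (extend (n' + δ • dualShift p (r + 1)))
          (extend γ) (extend (compl y N)) k =
        (∏ k ∈ Finset.range (p - (r + 1)), extFactor (extend n') (extend γ)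
          (extend (compl y N)) k) *
        levelFactor (fun i => (seqSum (extend n) (p - i) : ℕ)) (levelParam γ)
          (fun i => seqSum (extend (compl y N)) (p - i + 1)) (fun i => extend γ (p - i)) r k e := by
      rw [hpm, Finset.prod_range_succ, hm]
      congr 1
      · refine Finset.prod_congr rfl fun i hi => ?_
        have hi := Finset.mem_range.mp hi
        rw [extFactor, extFactor, hlow i hi, hlowsum i hi.le]
      · rw [extFactor, levelFactor, hmid, hlowsum m le_rfl, hsum, levelParam, psum_eq_seqSum]
        simp only [hm, hpm, Int.toNat_natCast]
        congr 1
        · push_cast; ring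
        · push_cast; ring
        · push_cast; ring
    rw [hC] at key
    convert key using 3
    module

/-- The actual data are inserted into `levelOp_of_isProductForm`. Level `i` carries `N_1^{p-i}` and
`Y_1^{p-i+1}`, so the level `j` reached at the end gives the eigenvalue `N - Y_1^{p+1-j}`. -/
theorem hahnOpN_hahnExt {j : ℕ} (hj : 1 ≤ j) (hjp : j ≤ p) (hreg : Regular j n γ N)
    (c : (Fin p → ℤ) → ℝ) :
    hahnOpN j γ N (hahnExt c y γ N) (fun i => (n i : ℤ)) =
      (N - psum y (p + 1 - j)) * hahnH n y γ N := by
  obtain ⟨hN, hγ, hz⟩ := hreg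
  have hS0 : seqSum (extend n) (p - 0) = ∑ i, n i := by
    rw [Nat.sub_zero, seqSum_extend_self]
  have hT : levelSum (fun i => (n i : ℤ)) = fun i => ((seqSum (extend n) (p - i) : ℕ) : ℝ) := by
    funext i
    rw [levelSum, ← cast_psum_eq_seqSum]
    simp
  have hYj : seqSum (extend (compl y N)) (p - j + 1) = psum y (p + 1 - j) := by
    rw [psum_eq_seqSum, show p + 1 - j = p - j + 1 by omega]
    refine Finset.sum_congr rfl fun i hi => ?_
    have hi : i < p := by have := Finset.mem_range.mp hi; omega
    rw [extend, dif_pos (by omega), extend, dif_pos hi, compl]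
    exact Fin.snoc_castSucc (α := fun _ => ℝ) _ y ⟨i, hi⟩
  have hform := isProductForm_hahnExt n γ N y c j hjp 0 (fun i => (n i : ℤ))
    (fun i _ => by positivity)
    (by
      rw [add_zero, seqSum, seqSum]
      push_cast
      refine Finset.sum_congr rfl fun i _ => ?_
      unfold extend
      split <;> simp)
    (fun i _ => by simp) (fun i _ => rfl)
  simp only [sub_self, add_zero] at hform
  have main := (levelOp_of_isProductForm (fun i => dualShift p (i + 1))
    (fun i => seqSum (extend n) (p - i)) (fun i => extend n (p - i - 1)) (levelParam γ)
    (fun i => seqSum (extend (compl y N)) (p - i + 1)) (fun i => extend γ (p - i)) N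
    (fun i => (n i : ℤ)) (topFactor N (∑ i, n i)) j
    (by
      intro i hi
      have h : p - i = p - (i + 1) + 1 := by omega
      rw [h, seqSum_succ, show p - (i + 1) + 1 - 1 = p - (i + 1) by omega])
    (by
      intro i hi
      have h : p - i = p - (i + 1) + 1 := by omega
      simp only [levelParam, psum_eq_seqSum]
      rw [h, seqSum_succ (extend γ) (p - (i + 1) + 1)]
      push_cast
      ring)
    (by
      intro i hi
      have h := hz (p - i) (by omega) (by omega)
      rw [cast_psum_eq_seqSum] at h
      rw [levelParam]
      simpa only [add_assoc] using h)
    (by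
      intro i hi
      have h := hγ ⟨p - i - 1, by omega⟩
      rw [← hS0] at h
      rw [extend, dif_pos (by omega)]
      convert h using 4
      simp
      omega)
    (by
      rw [Nat.sub_zero, seqSum_extend_self, Fin.sum_univ_castSucc]
      simp [compl])
    (by
      simp only [hS0, topFactor]
      rw [poch_succ] at hN
      have h1 := left_ne_zero_of_mul hN
      have h2 := right_ne_zero_of_mul hN
      rw [show (((∑ i, n i : ℕ) : ℤ) + 1).toNat = (∑ i, n i) + 1 by omega,
        show (((∑ i, n i : ℕ) : ℤ) + 0).toNat = ∑ i, n i by omega, poch_succ]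
      field_simp
      ring)
    (by
      intro h
      simp only [hS0] at h
      simp only [hS0, topFactor]
      obtain ⟨t, ht⟩ := Nat.exists_eq_add_of_le h
      rw [ht, add_comm 1 t, poch_succ, poch_succ] at hN
      have h1 := left_ne_zero_of_mul (left_ne_zero_of_mul hN)
      have h2 := right_ne_zero_of_mul (left_ne_zero_of_mul hN)
      rw [ht, show (((1 + t : ℕ) : ℤ) + -1).toNat = t by omega,
        show (((1 + t : ℕ) : ℤ) + 0).toNat = t + 1 by omega, poch_succ]
      push_cast
      field_simp
      ring)).1 _ _ hform
  have hval : hahnExt c y γ N (fun i => (n i : ℤ)) = hahnH n y γ N := by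
    rw [hahnExt, if_pos (fun i => by positivity)]
    simp
  rw [hahnOpN_eq hjp, hT, main.2, ← main.1, hval, hYj]

end data

/-! ### Continuity in the parameters -/

theorem continuous_compl {p : ℕ} (y : Fin p → ℝ) (k : ℕ) :
    Continuous fun N : ℝ => psum (compl y N) k := by
  unfold psum
  refine continuous_finsetSum _ fun i _ => ?_
  split_ifs
  · induction i using Fin.lastCases with
    | last => simp only [compl, Fin.snoc_last]; fun_prop
    | cast i => simp only [compl, Fin.snoc_castSucc]; fun_prop
  · fun_prop

theorem continuousAt_hahnH {p : ℕ} (n : Fin p → ℕ) (y : Fin p → ℝ) (γ : Fin (p + 1) → ℝ) (N : ℝ)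
    (hN : poch (-N) (∑ i, n i) ≠ 0) (hγ : ∀ k : Fin p, poch (γ k.succ + 1) (n k) ≠ 0) :
    ContinuousAt (fun q : (Fin (p + 1) → ℝ) × ℝ => hahnH n y q.1 q.2) (γ, N) := by
  have hp : ∀ (k : ℕ) (f : (Fin (p + 1) → ℝ) × ℝ → ℝ), Continuous f →
      Continuous fun q => poch (f q) k := fun k f hf => (continuous_poch k).comp hf
  have hpsum : ∀ k, Continuous fun q : (Fin (p + 1) → ℝ) × ℝ => psum q.1 k := by
    intro k
    unfold psum
    refine continuous_finsetSum _ fun i _ => ?_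
    split_ifs <;> fun_prop
  have hcompl : ∀ k, Continuous fun q : (Fin (p + 1) → ℝ) × ℝ => psum (compl y q.2) k :=
    fun k => (continuous_compl y k).comp continuous_snd
  unfold hahnH
  refine ContinuousAt.mul (ContinuousAt.div continuousAt_const ?_ ?_) ?_
  · refine Continuous.continuousAt ((hp _ _ (by fun_prop)).mul
      (continuous_finsetProd _ fun k _ => hp _ _ (by fun_prop)))
  · exact mul_ne_zero hN (Finset.prod_ne_zero_iff.mpr fun k _ => hγ k)
  · refine Continuous.continuousAt (continuous_finsetProd _ fun k _ => ?_)
    exact continuous_hahn1 _ ((hcompl _).sub continuous_const)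
      ((continuous_const.add (hpsum _)).add continuous_const) (by fun_prop)
      ((hcompl _).sub continuous_const)

theorem poch_neg_ne_zero {N : ℝ} {t : ℕ} (h : ∀ M : ℕ, N = M → t ≤ M) : poch (-N) t ≠ 0 := by
  induction t with
  | zero => simp [poch_zero]
  | succ t ih =>
    rw [poch_succ]
    refine mul_ne_zero (ih fun M hM => (Nat.le_succ t).trans (h M hM)) fun h0 => ?_
    have := h t (by linarith)
    omega

end Hahn

end

theorem theorem5p2 (p j : ℕ) (hj : 1 ≤ j) (hjp : j ≤ p)
    (γ : Fin (p + 1) → ℝ) (N : ℝ) (n : Fin p → ℕ)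
    -- the polynomial `H_p(n;y;γ;N)` is defined (if `N ∈ ℕ` then `|n| ≤ N`)
    (hN : ∀ M : ℕ, N = M → ∑ i, n i ≤ M)
    (hγ : ∀ k : Fin p, Hahn.poch (γ k.succ + 1) (n k) ≠ 0) :
    -- the spectral equation in `y`
    (∀ y : Fin p → ℝ,
      Hahn.hahnOpY j γ N (fun y' => Hahn.hahnH n y' γ N) y =
        -(Hahn.psum (fun i => (n i : ℝ)) j *
            (Hahn.psum (fun i => (n i : ℝ)) j + j + Hahn.psum γ (j + 1))) *
          Hahn.hahnH n y γ N) ∧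
    -- the limit that defines the operator in `n` exists, and the spectral equation in `n` holds
    (Hahn.Regular j n γ N →
      (∀ F : (Fin p → ℤ) → ℝ,
        Tendsto (fun β₀ : ℝ =>
            Hahn.racahDualOp j (Hahn.hahnParam γ β₀) N F (fun i => (n i : ℤ)) / β₀)
          atTop (𝓝 (Hahn.hahnOpN j γ N F (fun i => (n i : ℤ))))) ∧
      ∀ (c : (Fin p → ℤ) → ℝ) (y : Fin p → ℝ),
        Hahn.hahnOpN j γ N (Hahn.hahnExt c y γ N) (fun i => (n i : ℤ)) =
          (N - Hahn.psum y (p + 1 - j)) * Hahn.hahnH n y γ N) ∧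
    -- at the other parameters, in particular for `N = |n|`, it holds in the limit
    (∀ (c : (Fin p → ℤ) → ℝ) (y : Fin p → ℝ),
      Tendsto (fun q : (Fin (p + 1) → ℝ) × ℝ =>
          Hahn.hahnOpN j q.1 q.2 (Hahn.hahnExt c y q.1 q.2) (fun i => (n i : ℤ)))
        (𝓝[{q | Hahn.Regular j n q.1 q.2}] (γ, N))
        (𝓝 ((N - Hahn.psum y (p + 1 - j)) * Hahn.hahnH n y γ N))) := by
  refine ⟨fun y => Hahn.hahnOpY_hahnH hjp n γ N y, fun hreg => ⟨fun F => ?_, fun c y =>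
    Hahn.hahnOpN_hahnExt n γ N y hj hjp hreg c⟩, fun c y => ?_⟩
  · rw [Hahn.hahnOpN_eq hjp]
    exact Hahn.tendsto_racahDualOp hjp γ N F _
  -- Only the right-hand side has to be continuous at `(γ, N)`: on the regular set the left-hand
  -- side equals it, which determines the limit although the operator itself may be singular there.
  · have hc : ContinuousAt (fun q : (Fin (p + 1) → ℝ) × ℝ =>
        (q.2 - Hahn.psum y (p + 1 - j)) * Hahn.hahnH n y q.1 q.2) (γ, N) :=
      (continuous_snd.sub continuous_const).continuousAt.mul
        (Hahn.continuousAt_hahnH n y γ N (Hahn.poch_neg_ne_zero hN) hγ)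
    refine (hc.tendsto.mono_left nhdsWithin_le_nhds).congr' ?_
    filter_upwards [self_mem_nhdsWithin] with q hq
    exact (Hahn.hahnOpN_hahnExt n q.1 q.2 y hj hjp hq c).symm
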